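/- For $x,\xi\in\mathbb{R}$ and a function $g$ on $\mathbb{R}$ let $(T_xg)(t)=g(t-x)$ and $(M_\xi g)(t)=e^{2\pi i\xi t}g(t)$. For $g\in L^2(\mathbb{R})$ and $\alpha,\beta>0$ let $\mathcal{G}(g,\alpha,\beta)=\{M_{\beta n}T_{\alpha k}g\}_{k,n\in\mathbb{Z}}$. This family is a frame for $L^2(\mathbb{R})$ if there are constants $A,B>0$ with $$A\|f\|_{L^2}^2\le\sum_{k,n\in\mathbb{Z}}|\langle f,M_{\beta n}T_{\alpha k}g\rangle|^2\le B\|f\|_{L^2}^2\qquad\text{for all } f\in L^2(\mathbb{R}),$$ and a Parseval frame if this holds with $A=B=1$. For $1\le p<\infty$ the modulation space $M^p(\mathbb{R})$ consists of the tempered distributions $f$ whose short-time Fourier transform $V_\psi f(x,w)=\langle f,M_wT_x\psi\rangle$ satisfies $\int_{\mathbb{R}}\int_{\mathbb{R}}|V_\psi f(x,w)|^p\,dx\,dw<\infty$, where $\psi\neq0$ is a Schwartz function; the space does not depend on the choice of $\psi$, and membership and non-membership below are asserted for every such $\psi$. (a) For all $\alpha,\beta>0$ with $\alpha\beta\le1$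 and all $1<q\le2$ there exists $g\in L^2(\mathbb{R})\cap M^q(\mathbb{R})$ such that $\mathcal{G}(g,\alpha,\beta)$ is a frame for $L^2(\mathbb{R})$ but $g\notin M^p(\mathbb{R})$ for every $1\le p<q$. In particular (the case $q=2$), the atom of a Gabor frame for $L^2(\mathbb{R})$ need not belong to $M^p(\mathbb{R})$ for any $1\le p<2$. (b) For all $\alpha,\beta>0$ with $\alpha\beta\le\frac12$ there exists $g\in M^2(\mathbb{R})=L^2(\mathbb{R})$ such that $\mathcal{G}(g,\alpha,\beta)$ is a Parseval frame for $L^2(\mathbb{R})$ but $g\notin M^p(\mathbb{R})$ for every $1\le p<2$. -/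

import Mathlib

open MeasureTheory
open scoped SchwartzMap ENNReal

noncomputable section

namespace Gabor

/-- The Hilbert space `L²(ℝ)` of complex-valued functions. -/
abbrev L2 : Type := Lp ℂ 2 (volume : Measure ℝ)

/-- The character `t ↦ e^{2π i ξ t}`. -/
def phase (ξ t : ℝ) : ℂ := Complex.exp (2 * Real.pi * Complex.I * ξ * t)

theorem phase_eq (ξ : ℝ) :
    phase ξ = fun t : ℝ => Complex.exp ((2 * Real.pi * Complex.I * ξ) * (t : ℂ)) := rfl

theorem norm_phase (ξ t : ℝ) : ‖phase ξ t‖ = 1 := by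
  have : phase ξ t = Complex.exp (((2 * Real.pi * ξ * t : ℝ) : ℂ) * Complex.I) := by
    unfold phase; congr 1; push_cast; ring
  rw [this, Complex.norm_exp_ofReal_mul_I]

theorem contDiff_phase (ξ : ℝ) {n : WithTop ℕ∞} : ContDiff ℝ n (phase ξ) := by
  rw [phase_eq]
  exact Complex.contDiff_exp.comp (contDiff_const.mul Complex.ofRealCLM.contDiff)

theorem iteratedDeriv_phase (ξ : ℝ) (n : ℕ) :
    iteratedDeriv n (phase ξ) = fun t => (2 * Real.pi * Complex.I * ξ) ^ n * phase ξ t := by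
  induction n with
  | zero => simp
  | succ n ih =>
    rw [iteratedDeriv_succ, ih]
    funext t
    have h : HasDerivAt (phase ξ) ((2 * Real.pi * Complex.I * ξ) * phase ξ t) t := by
      have h1 : HasDerivAt (fun s : ℝ => (2 * Real.pi * Complex.I * ξ) * (s : ℂ))
          (2 * Real.pi * Complex.I * ξ) t := by
        simpa using (Complex.ofRealCLM.hasDerivAt (x := t)).const_mul (2 * Real.pi * Complex.I * ξ)
      exact h1.cexp.congr_deriv (mul_comm _ _)
    rw [(h.const_mul _).deriv]
    ring

theorem hasTemperateGrowth_phase (ξ : ℝ) : (phase ξ).HasTemperateGrowth := by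
  refine ⟨contDiff_phase ξ, fun n => ⟨0, ‖2 * Real.pi * Complex.I * (ξ : ℂ)‖ ^ n, fun t => ?_⟩⟩
  rw [norm_iteratedFDeriv_eq_norm_iteratedDeriv, iteratedDeriv_phase]
  simp [norm_phase]

/-! ### Translation and modulation on `L²(ℝ)`, Gabor systems and frames -/

/-- The translation operator `(T_x g)(t) = g(t - x)` on `L²(ℝ)`. -/
def translate (x : ℝ) (g : L2) : L2 :=
  Lp.compMeasurePreserving (fun t : ℝ => t - x) (measurePreserving_sub_right volume x) g

theorem memLp_modulate (ξ : ℝ) (g : L2) :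
    MemLp (fun t : ℝ => phase ξ t * g t) 2 (volume : Measure ℝ) :=
  (Lp.memLp g).of_le_mul (c := 1)
    ((contDiff_phase ξ (n := 0)).continuous.aestronglyMeasurable.mul (Lp.aestronglyMeasurable g))
    (by simp [norm_phase])

/-- The modulation operator `(M_ξ g)(t) = e^{2π i ξ t} g(t)` on `L²(ℝ)`. -/
def modulate (ξ : ℝ) (g : L2) : L2 := (memLp_modulate ξ g).toLp _

/-- The Gabor system `{M_{βn} T_{αk} g}`, indexed by the pairs `(k, n) ∈ ℤ × ℤ`. -/
def gaborSystem (g : L2) (α β : ℝ) (kn : ℤ × ℤ) : L2 :=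
  modulate (β * kn.2) (translate (α * kn.1) g)

/-- The family `e` satisfies the frame inequality with frame bounds `A, B > 0`. The coefficient
`⟨f, e i⟩` (linear in `f`) is `inner ℂ (e i) f` in Mathlib's convention. -/
def HasFrameBounds {ι H : Type*} [NormedAddCommGroup H] [InnerProductSpace ℂ H]
    (e : ι → H) (A B : ℝ) : Prop :=
  0 < A ∧ 0 < B ∧ ∀ f : H, Summable (fun i => ‖inner ℂ (e i) f‖ ^ 2) ∧
    A * ‖f‖ ^ 2 ≤ ∑' i, ‖inner ℂ (e i) f‖ ^ 2 ∧
    ∑' i, ‖inner ℂ (e i) f‖ ^ 2 ≤ B * ‖f‖ ^ 2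

/-- `e` is a frame for the Hilbert space `H`. -/
def IsFrame {ι H : Type*} [NormedAddCommGroup H] [InnerProductSpace ℂ H] (e : ι → H) : Prop :=
  ∃ A B : ℝ, HasFrameBounds e A B

/-- `e` is a Parseval frame for `H`: a frame with frame bounds `A = B = 1`. -/
def IsParsevalFrame {ι H : Type*} [NormedAddCommGroup H] [InnerProductSpace ℂ H]
    (e : ι → H) : Prop :=
  HasFrameBounds e 1 1

/-! ### Short-time Fourier transform and modulation spaces -/

/-- The time-frequency shift `M_w T_x ψ` of a Schwartz function. -/
def schwartzShift (ψ : 𝓢(ℝ, ℂ)) (x w : ℝ) : 𝓢(ℝ, ℂ) :=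
  SchwartzMap.smulLeftCLM ℂ (phase w) (ψ.compSubConstCLM ℂ x)

theorem schwartzShift_apply (ψ : 𝓢(ℝ, ℂ)) (x w t : ℝ) :
    schwartzShift ψ x w t = phase w t * ψ (t - x) := by
  simp [schwartzShift, hasTemperateGrowth_phase]

/-- The complex conjugate of a Schwartz function. -/
def schwartzConj (φ : 𝓢(ℝ, ℂ)) : 𝓢(ℝ, ℂ) :=
  φ.postcompCLM (𝕜 := ℝ) (Complex.conjCLE : ℂ →L[ℝ] ℂ)

theorem schwartzConj_apply (φ : 𝓢(ℝ, ℂ)) (t : ℝ) :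
    schwartzConj φ t = (starRingEnd ℂ) (φ t) := rfl

/-- The short-time Fourier transform `V_ψ f (x, w) = ⟨f, M_w T_x ψ⟩` of a tempered distribution
`f` with window `ψ`. The pairing `⟨·, ·⟩` extends the inner product of `L²(ℝ)`, while a
`TemperedDistribution` acts linearly on test functions, so it is evaluated at the complex
conjugate of `M_w T_x ψ`. -/
def stft (ψ : 𝓢(ℝ, ℂ)) (f : 𝓢'(ℝ, ℂ)) (x w : ℝ) : ℂ :=
  f (schwartzConj (schwartzShift ψ x w))

/-- For `f ∈ L²(ℝ)`, the short-time Fourier transform is the usual integral. -/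
theorem stft_L2 (ψ : 𝓢(ℝ, ℂ)) (f : L2) (x w : ℝ) :
    stft ψ (f : 𝓢'(ℝ, ℂ)) x w =
      ∫ t : ℝ, f t * (starRingEnd ℂ) (phase w t * ψ (t - x)) := by
  simp [stft, schwartzConj_apply, schwartzShift_apply, mul_comm]

/-- The mixed norm `‖F‖_{L^{p,q}(ℝ²)}`: the `L^p` norm in the first variable, followed by the
`L^q` norm in the second one. -/
def mixedNorm (p q : ℝ≥0∞) (F : ℝ → ℝ → ℂ) : ℝ≥0∞ :=
  eLpNorm (fun w : ℝ => eLpNorm (fun x : ℝ => F x w) p volume) q volume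

/-- The modulation space `M^{p,q}(ℝ)`, with the norm defined through the window `ψ`. -/
def modulationSpace (ψ : 𝓢(ℝ, ℂ)) (p q : ℝ≥0∞) : Set 𝓢'(ℝ, ℂ) :=
  {f | mixedNorm p q (stft ψ f) < ⊤}

end Gabor

end

namespace Gabor

open FourierTransform Filter Topology

/-! ### The Plancherel theorem on `L¹ ∩ L²` -/

/-! The frame property constrains only the modulus of the atom, while membership in `M^p` also
depends on its phase. If `|g|² = β` on `[0, α)` and `g = 0` elsewhere, with `αβ ≤ 1`, then expanding
in Fourier series on intervals of length `1/β` shows that the Gabor system is a Parseval frame,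
whatever the phase of `g` (`isParsevalFrame_of_sq_norm_eq_indicator`).

The phase is a concatenation of chirps of rate `R j` on consecutive intervals of length `ℓ j` that
accumulate at `α`. A chirp of rate `R` and length `ℓ` has a Fourier transform of size about
`R^(-1/2)` on a band of length about `Rℓ`, so the `p`-th power of its `L^p` norm is about `ℓ R^(1 -
p/2)`. With `R j = 2^(j²)` and `ℓ j` comparable to `2^(-(j²(1 - q/2) + j))`, this quantity is about
`2^(j²(q - p)/2 - j)`: it is unbounded for `p < q` and geometrically small for `p = q`.

Both halves of the heuristic are made rigorous. For `p < q`, the windowed atom is tested against a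
single chirp, whose Fourier transform is uniformly `O(R^(-1/2))`; by Parseval this bounds the `L^p`
norm from below (`enorm_integral_mul_conj_le`, `lintegral_fourier_chirpTrain_eq_top`). For `p = q`,
the `L²` norm on the band and integration by parts off it bound each piece
(`lintegral_rpow_le_of_band`), and Minkowski's inequality sums the pieces
(`chirpTrain_mem_modulationSpace`). The decay `1/|w|` off the band is `q`-integrable because `q >
1`. -/

theorem fourier_toLp_ae_eq {f : ℝ → ℂ} (hf₁ : Integrable f) (hf₂ : MemLp f 2) :
    ((𝓕 (hf₂.toLp f) : L2) : ℝ → ℂ) =ᵐ[volume] 𝓕 f := by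
  have hcont : Continuous (𝓕 f) :=
    VectorFourier.fourierIntegral_continuous Real.continuous_fourierChar
      (by fun_prop) hf₁
  refine ae_eq_of_integral_contDiff_smul_eq
    ((Lp.memLp _).locallyIntegrable (by norm_num)) hcont.locallyIntegrable fun φ hφ hc => ?_
  have hc' : HasCompactSupport (fun t => (φ t : ℂ)) := hc.comp_left (g := Complex.ofReal) rfl
  have hφ' : ContDiff ℝ (↑(⊤ : ℕ∞)) (fun t => (φ t : ℂ)) :=
    Complex.ofRealCLM.contDiff.comp hφ
  set Φ : 𝓢(ℝ, ℂ) := hc'.toSchwartzMap hφ' with hΦ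
  -- Tested against `Φ`, the `L²` transform acts by moving `𝓕` onto `Φ`; for integrable `f` the
  -- multiplication formula `h2` moves it back onto `f` as the classical integral.
  have h1 := congrArg (fun T : 𝓢'(ℝ, ℂ) => T Φ)
    (Lp.fourier_toTemperedDistribution_eq (hf₂.toLp f))
  simp only [TemperedDistribution.fourier_apply, Lp.toTemperedDistribution_apply] at h1
  have hΦa : ∀ t, Φ t = (φ t : ℂ) := fun t => rfl
  have h2 := VectorFourier.integral_fourierIntegral_smul_eq_flip (L := innerₗ ℝ)
    (μ := volume) (ν := volume) (f := Φ) (g := f)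
    Real.continuous_fourierChar continuous_inner Φ.integrable hf₁
  have h3 : ∫ x, (𝓕 Φ) x • (hf₂.toLp f) x = ∫ x, (𝓕 Φ) x • f x := by
    refine integral_congr_ae ?_
    filter_upwards [hf₂.coeFn_toLp] with x hx
    rw [hx]
  rw [h3] at h1
  simp only [flip_innerₗ] at h2
  have h4 : ∫ x, (𝓕 Φ) x • f x = ∫ x, Φ x • 𝓕 f x := h2
  rw [h4] at h1
  simpa [hΦa] using h1.symm

theorem memLp_fourier {f : ℝ → ℂ} (hf₁ : Integrable f) (hf₂ : MemLp f 2) :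
    MemLp (𝓕 f) 2 :=
  (memLp_congr_ae (fourier_toLp_ae_eq hf₁ hf₂)).1 (Lp.memLp _)

theorem eLpNorm_fourier {f : ℝ → ℂ} (hf₁ : Integrable f) (hf₂ : MemLp f 2) :
    eLpNorm (𝓕 f) 2 volume = eLpNorm f 2 volume := by
  rw [← eLpNorm_congr_ae (fourier_toLp_ae_eq hf₁ hf₂), ← eLpNorm_congr_ae hf₂.coeFn_toLp,
    ← Lp.enorm_def, ← Lp.enorm_def, ← ofReal_norm, ← ofReal_norm, Lp.norm_fourier_eq]

theorem lintegral_enorm_fourier_sq {f : ℝ → ℂ} (hf₁ : Integrable f) (hf₂ : MemLp f 2) :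
    ∫⁻ w, ‖𝓕 f w‖ₑ ^ (2 : ℝ) = ∫⁻ t, ‖f t‖ₑ ^ (2 : ℝ) := by
  have h := eLpNorm_fourier hf₁ hf₂
  rw [eLpNorm_eq_lintegral_rpow_enorm_toReal (by norm_num) (by norm_num),
    eLpNorm_eq_lintegral_rpow_enorm_toReal (by norm_num) (by norm_num)] at h
  have h' := ENNReal.rpow_left_injective (x := 1 / ENNReal.toReal 2) (by norm_num) h
  simpa using h'

theorem integral_conj_fourier_mul_fourier {h f : ℝ → ℂ} (hh₁ : Integrable h) (hh₂ : MemLp h 2)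
    (hf₁ : Integrable f) (hf₂ : MemLp f 2) :
    ∫ w, 𝓕 f w * (starRingEnd ℂ) (𝓕 h w) = ∫ t, f t * (starRingEnd ℂ) (h t) := by
  have key := Lp.inner_fourier_eq (hh₂.toLp h) (hf₂.toLp f)
  rw [L2.inner_def, L2.inner_def] at key
  refine Eq.trans (integral_congr_ae ?_) (key.trans (integral_congr_ae ?_))
  · filter_upwards [fourier_toLp_ae_eq hh₁ hh₂, fourier_toLp_ae_eq hf₁ hf₂] with w h1 h2
    rw [h1, h2]; rfl
  · filter_upwards [hh₂.coeFn_toLp, hf₂.coeFn_toLp] with w h1 h2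
    rw [h1, h2]; rfl

/-! ### Tight Gabor frames with compactly supported atoms -/

theorem conj_phase (ξ t : ℝ) : (starRingEnd ℂ) (phase ξ t) = phase (-ξ) t := by
  simp only [phase, ← Complex.exp_conj, map_mul, Complex.conj_ofReal, Complex.conj_I, map_ofNat]
  congr 1; push_cast; ring

theorem gaborSystem_toLp_ae_eq {g₀ : ℝ → ℂ} (hg₀ : MemLp g₀ 2) (α β : ℝ) (k n : ℤ) :
    (gaborSystem (hg₀.toLp g₀) α β (k, n) : ℝ → ℂ) =ᵐ[volume]
      fun t => phase (β * n) t * g₀ (t - α * k) := by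
  have h1 := (memLp_modulate (β * n) (translate (α * k) (hg₀.toLp g₀))).coeFn_toLp
  have h2 := Lp.coeFn_compMeasurePreserving (hg₀.toLp g₀)
    (measurePreserving_sub_right volume (α * k))
  have h3 := (measurePreserving_sub_right volume (α * k)).quasiMeasurePreserving.ae_eq_comp
    hg₀.coeFn_toLp
  filter_upwards [h1, h2, h3] with t h1 h2 h3
  simp only [gaborSystem, modulate, translate] at h1 ⊢
  rw [h1, h2, h3]
  rfl

/-- For fixed `k`, the product of `f` with the conjugated translate lives on an interval of length
`α ≤ 1/β`. The coefficients over `n` are therefore, up to the factor `1/β`, its Fourier coefficients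
on an interval of length `1/β`, and Parseval's identity for Fourier series applies. -/
theorem hasSum_sq_inner_gaborSystem {g₀ : ℝ → ℂ} {α β : ℝ} (hβ : 0 < β)
    (hαβ : α * β ≤ 1) (hm : Measurable g₀)
    (hg : ∀ t, ‖g₀ t‖ ^ 2 = (Set.Ico 0 α).indicator (fun _ => β) t) (hL : MemLp g₀ 2)
    (f : L2) (k : ℤ) :
    HasSum (fun n : ℤ => ‖inner ℂ (gaborSystem (hL.toLp g₀) α β (k, n)) f‖ ^ 2)
      (∫ t in Set.Ico (k • α) ((k + 1) • α), ‖f t‖ ^ 2) := by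
  have hb : ∀ t, ‖g₀ t‖ ≤ Real.sqrt β := fun t => by
    rw [← Real.sqrt_sq (norm_nonneg (g₀ t)), hg t]
    refine Real.sqrt_le_sqrt ?_
    by_cases h : t ∈ Set.Ico 0 α <;> simp [h, hβ.le]
  have hz : ∀ t ∉ Set.Ico 0 α, g₀ t = 0 := fun t ht => by
    have := hg t
    rw [Set.indicator_of_notMem ht] at this
    simpa using this
  set a : ℝ := α * k with ha
  have hab : a < a + β⁻¹ := by have := inv_pos.2 hβ; linarith
  have hαb : α ≤ β⁻¹ := by rw [← one_div, le_div_iff₀ hβ]; exact hαβ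
  set F : ℝ → ℂ := fun t => (starRingEnd ℂ) (g₀ (t - a)) * f t with hF
  have hFm : AEStronglyMeasurable F volume :=
    ((Complex.continuous_conj.measurable.comp
      (hm.comp (measurable_id.sub_const a))).aestronglyMeasurable).mul (Lp.aestronglyMeasurable f)
  have hFL : MemLp F 2 volume := by
    refine (Lp.memLp f).of_le_mul (c := Real.sqrt β) hFm (Filter.Eventually.of_forall fun t => ?_)
    simp only [hF, norm_mul, RCLike.norm_conj]
    exact mul_le_mul_of_nonneg_right (hb _) (norm_nonneg _)
  have hFz : ∀ t ∉ Set.Ico a (a + β⁻¹), F t = 0 := fun t ht => by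
    have : g₀ (t - a) = 0 := hz _ fun h => ht ⟨by linarith [h.1], by linarith [h.2]⟩
    simp [hF, this]
  have hS := hasSum_sq_fourierCoeffOn hab (hFL.restrict _)
  have hcoef : ∀ n : ℤ, inner ℂ (gaborSystem (hL.toLp g₀) α β (k, n)) f
      = (β⁻¹ : ℝ) • fourierCoeffOn hab F n := fun n => by
    rw [fourierCoeffOn_eq_integral, L2.inner_def, smul_smul, add_sub_cancel_left,
      mul_one_div_cancel (inv_pos.2 hβ).ne', one_smul,
      intervalIntegral.integral_of_le hab.le, ← integral_Ico_eq_integral_Ioc,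
      setIntegral_eq_integral_of_forall_compl_eq_zero
        (fun t ht => by rw [hFz t ht, smul_zero])]
    refine integral_congr_ae ?_
    filter_upwards [gaborSystem_toLp_ae_eq hL α β k n] with t ht
    rw [ht, fourier_coe_apply]
    simp only [hF, RCLike.inner_apply, map_mul, conj_phase, smul_eq_mul]
    have : phase (-(β * n)) t
        = Complex.exp (2 * Real.pi * Complex.I * ((-n : ℤ) : ℂ) * t / ((β⁻¹ : ℝ) : ℂ)) := by
      unfold phase; congr 1; push_cast; field_simp
    rw [this]; ring
  -- The normalisations cancel: `β⁻²` from the coefficients, `β` from averaging over length `1/β`,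
  -- and `β` from `|g₀|²`.
  have hval : (β⁻¹) ^ 2 * ((a + β⁻¹ - a)⁻¹ • ∫ x in a..(a + β⁻¹), ‖F x‖ ^ 2)
      = ∫ t in Set.Ico (k • α) ((k + 1) • α), ‖f t‖ ^ 2 := by
    rw [intervalIntegral.integral_of_le hab.le, ← integral_Ico_eq_integral_Ioc,
      setIntegral_eq_integral_of_forall_compl_eq_zero
        (fun t ht => by rw [hFz t ht]; simp), add_sub_cancel_left, inv_inv, smul_eq_mul,
      ← integral_indicator measurableSet_Ico, ← mul_assoc, ← integral_const_mul]
    refine integral_congr_ae (Filter.Eventually.of_forall fun t => ?_)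
    have hmem : t - a ∈ Set.Ico 0 α ↔ t ∈ Set.Ico (k • α) ((k + 1) • α) := by
      simp only [Set.mem_Ico, zsmul_eq_mul, ha]; push_cast
      constructor <;> rintro ⟨h1, h2⟩ <;> constructor <;> linarith
    simp only [hF, norm_mul, RCLike.norm_conj, mul_pow, hg]
    by_cases h : t ∈ Set.Ico (k • α) ((k + 1) • α)
    · rw [Set.indicator_of_mem h, Set.indicator_of_mem (hmem.2 h)]
      field_simp
    · rw [Set.indicator_of_notMem h, Set.indicator_of_notMem (fun h' => h (hmem.1 h'))]
      ring
  rw [← hval]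
  simp only [hcoef, norm_smul, mul_pow, Real.norm_eq_abs, sq_abs]
  exact hS.mul_left ((β⁻¹) ^ 2)

/-- The translates of `[0, α)` by `αℤ` tile the line, so the local identities for each `k` add up to
`‖f‖²`. -/
theorem isParsevalFrame_of_sq_norm_eq_indicator {g₀ : ℝ → ℂ} {α β : ℝ} (hα : 0 < α) (hβ : 0 < β)
    (hαβ : α * β ≤ 1) (hm : Measurable g₀)
    (hg : ∀ t, ‖g₀ t‖ ^ 2 = (Set.Ico 0 α).indicator (fun _ => β) t) (hL : MemLp g₀ 2) :
    IsParsevalFrame (gaborSystem (hL.toLp g₀) α β) := by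
  refine ⟨one_pos, one_pos, fun f => ?_⟩
  have hinteg : Integrable (fun t => ‖f t‖ ^ 2) := (Lp.memLp f).integrable_norm_pow (by norm_num)
  have hdisj : Pairwise (Function.onFun Disjoint
      fun k : ℤ => Set.Ico (k • α) ((k + 1) • α)) := by
    simpa using Set.pairwise_disjoint_Ico_add_zsmul (0 : ℝ) α
  have hrow := hasSum_sq_inner_gaborSystem hβ hαβ hm hg hL f
  have hcol := hasSum_integral_iUnion (fun k : ℤ => measurableSet_Ico)
    hdisj (hinteg.integrableOn (s := ⋃ k : ℤ, Set.Ico (k • α) ((k + 1) • α)))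
  rw [iUnion_Ico_zsmul hα, setIntegral_univ] at hcol
  have hsum : Summable fun i => ‖inner ℂ (gaborSystem (hL.toLp g₀) α β i) f‖ ^ 2 := by
    refine (summable_prod_of_nonneg fun i => by positivity).2 ⟨fun k => (hrow k).summable, ?_⟩
    simpa only [(hrow _).tsum_eq] using hcol.summable
  have hnorm : ∫ t, ‖f t‖ ^ 2 = ‖f‖ ^ 2 := by
    have h := congrArg RCLike.re (L2.inner_def (𝕜 := ℂ) f f)
    rw [← integral_re (L2.integrable_inner f f)] at h
    simp only [← norm_sq_eq_re_inner] at h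
    exact h.symm
  have htot : ∑' i, ‖inner ℂ (gaborSystem (hL.toLp g₀) α β i) f‖ ^ 2 = ‖f‖ ^ 2 := by
    rw [← hnorm]
    exact (hsum.hasSum.prod_fiberwise hrow).unique hcol
  exact ⟨hsum, by rw [htot, one_mul], by rw [htot, one_mul]⟩

/-! ### Oscillatory integrals with quadratic phase -/

/-- The linear chirp `e^{2π i R (t - a)²}`. -/
noncomputable def chirp (R a t : ℝ) : ℂ :=
  Complex.exp ((2 * Real.pi * (R * (t - a) ^ 2) : ℝ) * Complex.I)

theorem norm_chirp (R a t : ℝ) : ‖chirp R a t‖ = 1 := Complex.norm_exp_ofReal_mul_I _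

theorem continuous_chirp (R a : ℝ) : Continuous (chirp R a) := by
  unfold chirp; fun_prop

theorem hasDerivAt_chirp_mul_phase (R a w t : ℝ) :
    HasDerivAt (fun t => chirp R a t * phase (-w) t)
      (((2 * Real.pi * (2 * R * (t - a) - w) : ℝ) : ℂ) * Complex.I *
        (chirp R a t * phase (-w) t)) t := by
  have h1 : HasDerivAt (fun t : ℝ => 2 * Real.pi * (R * (t - a) ^ 2 - w * t))
      (2 * Real.pi * (2 * R * (t - a) - w)) t := by
    have h := (((((hasDerivAt_id t).sub_const a).pow 2).const_mul R).sub
      ((hasDerivAt_id t).const_mul w)).const_mul (2 * Real.pi)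
    refine h.congr_deriv ?_
    simp only [id, Nat.cast_ofNat]; ring
  have h2 := (h1.ofReal_comp.mul_const Complex.I).cexp
  have he : (fun t => chirp R a t * phase (-w) t) = fun t : ℝ =>
      Complex.exp (((2 * Real.pi * (R * (t - a) ^ 2 - w * t) : ℝ) : ℂ) * Complex.I) := by
    funext s
    rw [chirp, phase, ← Complex.exp_add]
    congr 1; push_cast; ring
  have he' := congrFun he t
  rw [he, show chirp R a t * phase (-w) t = _ from he']
  exact h2.congr_deriv (mul_comm _ _)

/-- Integration by parts away from the stationary point of the phase. -/
theorem integral_chirp_mul_phase_eq {R a w c d : ℝ} {A A' : ℝ → ℂ}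
    (hρ : ∀ t ∈ Set.uIcc c d, 2 * R * (t - a) - w ≠ 0)
    (hA : ∀ t, HasDerivAt A (A' t) t) (hA' : Continuous A') :
    ∫ t in c..d, chirp R a t * phase (-w) t * A t =
      (chirp R a d * phase (-w) d * A d / ((2 * Real.pi * (2 * R * (d - a) - w) : ℝ) * Complex.I)
        - chirp R a c * phase (-w) c * A c /
          ((2 * Real.pi * (2 * R * (c - a) - w) : ℝ) * Complex.I))
      - ∫ t in c..d, chirp R a t * phase (-w) t *
        (A' t / ((2 * Real.pi * (2 * R * (t - a) - w) : ℝ) * Complex.I)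
          - A t * (2 * R : ℝ) /
            ((2 * Real.pi * (2 * R * (t - a) - w) ^ 2 : ℝ) * Complex.I)) := by
  have hpi := Real.pi_pos.ne'
  have hAc : Continuous A := continuous_iff_continuousAt.2 fun t => (hA t).continuousAt
  have hpc : Continuous (phase (-w)) := (contDiff_phase (-w) (n := 0)).continuous
  have hcc := continuous_chirp R a
  have hne : ∀ t ∈ Set.uIcc c d,
      ((2 * Real.pi * (2 * R * (t - a) - w) : ℝ) : ℂ) * Complex.I ≠ 0 := fun t ht =>
    mul_ne_zero (Complex.ofReal_ne_zero.2 (by have := hρ t ht; positivity)) Complex.I_ne_zero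
  have hne2 : ∀ t ∈ Set.uIcc c d,
      ((2 * Real.pi * (2 * R * (t - a) - w) ^ 2 : ℝ) : ℂ) * Complex.I ≠ 0 := fun t ht =>
    mul_ne_zero (Complex.ofReal_ne_zero.2 (by have := hρ t ht; positivity)) Complex.I_ne_zero
  have hi1 : IntervalIntegrable (fun t => chirp R a t * phase (-w) t * A t) volume c d :=
    ((hcc.mul hpc).mul hAc).intervalIntegrable _ _
  have hi2 : IntervalIntegrable (fun t => chirp R a t * phase (-w) t *
        (A' t / ((2 * Real.pi * (2 * R * (t - a) - w) : ℝ) * Complex.I)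
          - A t * (2 * R : ℝ) /
            ((2 * Real.pi * (2 * R * (t - a) - w) ^ 2 : ℝ) * Complex.I))) volume c d := by
    refine ContinuousOn.intervalIntegrable ?_
    refine (hcc.mul hpc).continuousOn.mul (ContinuousOn.sub ?_ ?_)
    · exact hA'.continuousOn.div (by fun_prop) hne
    · exact (hAc.mul continuous_const).continuousOn.div (by fun_prop) hne2
  rw [eq_sub_iff_add_eq, ← intervalIntegral.integral_add hi1 hi2]
  refine intervalIntegral.integral_eq_sub_of_hasDerivAt
    (f := fun t => chirp R a t * phase (-w) t * A t /
      ((2 * Real.pi * (2 * R * (t - a) - w) : ℝ) * Complex.I)) (fun t ht => ?_) (hi1.add hi2)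
  have hden : HasDerivAt (fun t : ℝ => ((2 * Real.pi * (2 * R * (t - a) - w) : ℝ) : ℂ) * Complex.I)
      (((2 * Real.pi * (2 * R) : ℝ) : ℂ) * Complex.I) t := by
    refine HasDerivAt.mul_const (HasDerivAt.ofReal_comp ?_) _
    have h := ((((hasDerivAt_id t).sub_const a).const_mul (2 * R)).sub_const w).const_mul
      (2 * Real.pi)
    simpa using h
  refine (((hasDerivAt_chirp_mul_phase R a w t).mul (hA t)).div hden (hne t ht)).congr_deriv ?_
  have hr : ((2 * R * (t - a) - w : ℝ) : ℂ) ≠ 0 := Complex.ofReal_ne_zero.2 (hρ t ht)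
  have hp : (Real.pi : ℂ) ≠ 0 := Complex.ofReal_ne_zero.2 hpi
  have hI := Complex.I_ne_zero
  simp only [Complex.ofReal_mul (2 * Real.pi), Complex.ofReal_pow, Pi.mul_apply]
  generalize ((2 * R * (t - a) - w : ℝ) : ℂ) = r at hr
  push_cast
  field_simp
  ring

/-- Integration by parts leaves boundary terms of size `1/(4πU)` and `1/(4π)` and a remainder of at
most `(1 - 1/U)/(4π)`; the total is `1/(2π)`, independent of `U`. -/
theorem norm_integral_chirp_le_of_one_le {U : ℝ} (hU : 1 ≤ U) :
    ‖∫ u in (1 : ℝ)..U, chirp 1 0 u‖ ≤ 1 := by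
  have h := integral_chirp_mul_phase_eq (R := 1) (a := 0) (w := 0) (c := 1) (d := U)
    (A := fun _ => 1) (A' := fun _ => 0)
    (fun t ht => by
      rw [Set.uIcc_of_le hU] at ht
      have := ht.1; simp; linarith) (fun t => hasDerivAt_const _ _) continuous_const
  have hp0 : ∀ t, phase (-0) t = 1 := fun t => by simp [phase]
  simp only [hp0, mul_one] at h
  rw [h]
  have hpi := Real.pi_gt_three
  have e1 : ∀ t : ℝ, 1 ≤ t → ‖chirp 1 0 t / ((2 * Real.pi * (2 * 1 * (t - 0) - 0) : ℝ) * Complex.I)‖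
      = (4 * Real.pi * t)⁻¹ := fun t ht => by
    rw [norm_div, norm_chirp, norm_mul, Complex.norm_I, mul_one, Complex.norm_real,
      sub_zero, sub_zero, mul_one, Real.norm_of_nonneg (by positivity), one_div]
    congr 1; ring
  have hsq : IntervalIntegrable (fun u : ℝ => (4 * Real.pi)⁻¹ * (u ^ 2)⁻¹) volume 1 U := by
    refine ContinuousOn.intervalIntegrable (ContinuousOn.mul continuousOn_const
      (ContinuousOn.inv₀ (continuous_pow 2).continuousOn fun u hu => ?_))
    rw [Set.uIcc_of_le hU] at hu
    have := hu.1; positivity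
  have hFTC : ∫ u in (1 : ℝ)..U, (4 * Real.pi)⁻¹ * (u ^ 2)⁻¹ = (4 * Real.pi)⁻¹ * (1 - U⁻¹) := by
    have hd : ∀ u ∈ Set.uIcc 1 U, HasDerivAt (fun u => -((4 * Real.pi)⁻¹ * u⁻¹))
        ((4 * Real.pi)⁻¹ * (u ^ 2)⁻¹) u := fun u hu => by
      rw [Set.uIcc_of_le hU] at hu
      have := ((hasDerivAt_inv (show u ≠ 0 by linarith [hu.1])).const_mul (4 * Real.pi)⁻¹).neg
      exact this.congr_deriv (by ring)
    rw [intervalIntegral.integral_eq_sub_of_hasDerivAt hd hsq]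
    ring
  have e2 := intervalIntegral.norm_integral_le_of_norm_le (μ := volume) hU
    (f := fun t => chirp 1 0 t * (0 / ((2 * Real.pi * (2 * 1 * (t - 0) - 0) : ℝ) * Complex.I)
      - 1 * (2 * 1 : ℝ) / ((2 * Real.pi * (2 * 1 * (t - 0) - 0) ^ 2 : ℝ) * Complex.I)))
    (g := fun u => (4 * Real.pi)⁻¹ * (u ^ 2)⁻¹)
    (Filter.Eventually.of_forall fun t ht => by
      have ht1 := ht.1
      rw [norm_mul, norm_chirp, zero_div, zero_sub, norm_neg, norm_div, norm_mul, norm_mul,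
        Complex.norm_I, Complex.norm_real, Complex.norm_real,
        Real.norm_of_nonneg (by positivity), Real.norm_of_nonneg (by positivity)]
      apply le_of_eq
      have : t ≠ 0 := by linarith
      simp
      field_simp
      norm_num) hsq
  rw [hFTC] at e2
  simp only [one_mul] at e2
  have e3 : (4 * Real.pi * U)⁻¹ = (4 * Real.pi)⁻¹ * U⁻¹ := mul_inv _ _
  have e4 : (4 * Real.pi * 1)⁻¹ ≤ (1 / 12 : ℝ) := by
    rw [one_div]; apply inv_anti₀ <;> linarith
  have n1 := norm_sub_le (chirp 1 0 U / ((2 * Real.pi * (2 * 1 * (U - 0) - 0) : ℝ) * Complex.I))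
    (chirp 1 0 1 / ((2 * Real.pi * (2 * 1 * (1 - 0) - 0) : ℝ) * Complex.I))
  rw [e1 U hU, e1 1 le_rfl, e3] at n1
  refine (norm_sub_le _ _).trans ?_
  simp only [one_mul, mul_one] at *
  linarith

/-- The trivial bound covers the neighbourhood of the stationary point, oscillation covers `[1, U]`,
and evenness of the chirp covers negative `U`. -/
theorem norm_integral_chirp_zero_le (U : ℝ) : ‖∫ u in (0 : ℝ)..U, chirp 1 0 u‖ ≤ 2 := by
  have hinteg : ∀ c d, IntervalIntegrable (chirp 1 0) volume c d := fun c d =>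
    (continuous_chirp 1 0).intervalIntegrable c d
  have small : ∀ c d : ℝ, |d - c| ≤ 1 → ‖∫ u in c..d, chirp 1 0 u‖ ≤ 1 := fun c d h => by
    have := intervalIntegral.norm_integral_le_of_norm_le_const (a := c) (b := d)
      (f := chirp 1 0) (C := 1) (fun t _ => (norm_chirp 1 0 t).le)
    linarith
  have pos : ∀ U : ℝ, 0 ≤ U → ‖∫ u in (0 : ℝ)..U, chirp 1 0 u‖ ≤ 2 := fun U hU => by
    rcases le_total U 1 with h | h
    · exact (small 0 U (by rw [sub_zero, abs_of_nonneg hU]; exact h)).trans one_le_two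
    · rw [← intervalIntegral.integral_add_adjacent_intervals (hinteg 0 1) (hinteg 1 U)]
      have h1 := small 0 1 (by simp)
      have h2 := norm_integral_chirp_le_of_one_le h
      exact (norm_add_le _ _).trans (by linarith)
  rcases le_total 0 U with h | h
  · exact pos U h
  · have := pos (-U) (by linarith)
    have e := intervalIntegral.integral_comp_neg (a := 0) (b := U) (chirp 1 0)
    have ev : ∀ u, chirp 1 0 (-u) = chirp 1 0 u := fun u => by simp [chirp]
    simp only [ev, neg_zero] at e
    rwa [e, intervalIntegral.integral_symm, norm_neg]

/-- The Fourier transform of a truncated chirp of rate `R` is `O(R^{-1/2})`. -/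
theorem norm_integral_chirp_mul_phase_le {R : ℝ} (hR : 0 < R) (a w c d : ℝ) :
    ‖∫ t in c..d, chirp R a t * phase (-w) t‖ ≤ 4 / Real.sqrt R := by
  have hs := Real.sqrt_pos.2 hR
  have hss : Real.sqrt R * Real.sqrt R = R := Real.mul_self_sqrt hR.le
  set s := Real.sqrt R
  set e := s * (a + w / (2 * R)) with he
  -- Completing the square absorbs the frequency `w` into a translation and a unimodular constant.
  -- Rescaling by `s = √R` then reduces to the unit chirp and produces the factor `1/√R`.
  obtain ⟨z, hz, hzeq⟩ : ∃ z : ℂ, ‖z‖ = 1 ∧ ∀ t, chirp R a t * phase (-w) t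
      = z * chirp 1 0 (s * t - e) := by
    refine ⟨Complex.exp ((2 * Real.pi * (-(w * a) - w ^ 2 / (4 * R)) : ℝ) * Complex.I),
      Complex.norm_exp_ofReal_mul_I _, fun t => ?_⟩
    rw [chirp, chirp, phase, ← Complex.exp_add, ← Complex.exp_add]
    congr 1
    have : R * (t - a) ^ 2 - w * t
        = -(w * a) - w ^ 2 / (4 * R) + 1 * (s * t - e - 0) ^ 2 := by
      have : (s * t - e - 0) ^ 2 = R * (t - (a + w / (2 * R))) ^ 2 := by
        rw [he, ← hss]; ring
      rw [this]; field_simp; ring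
    have h2 : ((2 * Real.pi * (R * (t - a) ^ 2 - w * t) : ℝ) : ℂ) * Complex.I = _ :=
      congrArg (fun r : ℝ => ((2 * Real.pi * r : ℝ) : ℂ) * Complex.I) this
    push_cast at h2 ⊢
    linear_combination h2
  simp only [hzeq]
  rw [intervalIntegral.integral_const_mul, norm_mul, hz, one_mul,
    intervalIntegral.integral_comp_mul_sub _ hs.ne', norm_smul, norm_inv, Real.norm_of_nonneg hs.le,
    div_eq_inv_mul]
  refine mul_le_mul_of_nonneg_left ?_ (inv_pos.2 hs).le
  have hinteg : ∀ c d, IntervalIntegrable (chirp 1 0) volume c d := fun c d =>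
    (continuous_chirp 1 0).intervalIntegrable c d
  rw [← intervalIntegral.integral_interval_sub_left (hinteg 0 _) (hinteg 0 _)]
  refine (norm_sub_le _ _).trans ?_
  linarith [norm_integral_chirp_zero_le (s * d - e), norm_integral_chirp_zero_le (s * c - e)]

/-- Decay of the Fourier transform of an amplitude-modulated chirp off its frequency band. -/
theorem norm_integral_chirp_mul_phase_mul_le {R a b w K₀ K₁ : ℝ} {A A' : ℝ → ℂ} (hR : 0 ≤ R)
    (hab : a ≤ b) (hw : 4 * R * (b - a) ≤ |w|) (hw0 : w ≠ 0)
    (hA : ∀ t, HasDerivAt A (A' t) t) (hA' : Continuous A')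
    (hK₀ : ∀ t ∈ Set.Icc a b, ‖A t‖ ≤ K₀) (hK₁ : ∀ t ∈ Set.Icc a b, ‖A' t‖ ≤ K₁) :
    ‖∫ t in a..b, chirp R a t * phase (-w) t * A t‖ ≤ (K₀ + (b - a) * K₁) / |w| := by
  have hwp : 0 < |w| := abs_pos.2 hw0
  have hpi := Real.pi_gt_three
  have hK₀0 : 0 ≤ K₀ := (norm_nonneg _).trans (hK₀ a ⟨le_rfl, hab⟩)
  have hK₁0 : 0 ≤ K₁ := (norm_nonneg _).trans (hK₁ a ⟨le_rfl, hab⟩)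
  -- Off the band, `2R(t - a) ≤ |w|/2`, so the phase has no stationary point and its derivative is
  -- at least of order `|w|`.
  have hρ : ∀ t ∈ Set.Icc a b, |w| / 2 ≤ |2 * R * (t - a) - w| := fun t ht => by
    have h1 := abs_sub_abs_le_abs_sub w (2 * R * (t - a))
    rw [abs_sub_comm, abs_of_nonneg (mul_nonneg (by positivity) (sub_nonneg.2 ht.1))] at h1
    have h2 : 2 * R * (t - a) ≤ 2 * R * (b - a) :=
      mul_le_mul_of_nonneg_left (by linarith [ht.2]) (by positivity)
    linarith
  rw [integral_chirp_mul_phase_eq (fun t ht h => by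
    rw [Set.uIcc_of_le hab] at ht
    have := hρ t ht
    rw [h, abs_zero] at this
    linarith) hA hA']
  have hnp : ∀ t, ‖chirp R a t * phase (-w) t‖ = 1 := fun t => by
    rw [norm_mul, norm_chirp, norm_phase, one_mul]
  have hden : ∀ t ∈ Set.Icc a b,
      Real.pi * |w| ≤ ‖((2 * Real.pi * (2 * R * (t - a) - w) : ℝ) : ℂ) * Complex.I‖ :=
    fun t ht => by
      rw [norm_mul, Complex.norm_I, mul_one, Complex.norm_real, Real.norm_eq_abs, abs_mul,
        abs_of_pos (by positivity : 0 < 2 * Real.pi)]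
      nlinarith [hρ t ht]
  have hden2 : ∀ t ∈ Set.Icc a b,
      Real.pi * |w| ^ 2 / 2 ≤ ‖((2 * Real.pi * (2 * R * (t - a) - w) ^ 2 : ℝ) : ℂ) * Complex.I‖ :=
    fun t ht => by
      rw [norm_mul, Complex.norm_I, mul_one, Complex.norm_real, Real.norm_eq_abs, abs_mul,
        abs_of_pos (by positivity : 0 < 2 * Real.pi), abs_pow]
      have : (|w| / 2) ^ 2 ≤ |2 * R * (t - a) - w| ^ 2 := by gcongr; exact hρ t ht
      nlinarith
  have hbd : ∀ t ∈ Set.Icc a b, ‖chirp R a t * phase (-w) t * A t /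
      ((2 * Real.pi * (2 * R * (t - a) - w) : ℝ) * Complex.I)‖ ≤ K₀ / (Real.pi * |w|) :=
    fun t ht => by
      rw [norm_div, norm_mul, hnp, one_mul]
      exact div_le_div₀ hK₀0 (hK₀ t ht) (by positivity) (hden t ht)
  have hin : ‖∫ t in a..b, chirp R a t * phase (-w) t *
        (A' t / ((2 * Real.pi * (2 * R * (t - a) - w) : ℝ) * Complex.I)
          - A t * (2 * R : ℝ) /
            ((2 * Real.pi * (2 * R * (t - a) - w) ^ 2 : ℝ) * Complex.I))‖
      ≤ (K₁ / (Real.pi * |w|) + K₀ * (2 * R) / (Real.pi * |w| ^ 2 / 2)) * |b - a| := by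
    refine intervalIntegral.norm_integral_le_of_norm_le_const fun t ht => ?_
    rw [Set.uIoc_of_le hab] at ht
    have ht' : t ∈ Set.Icc a b := ⟨ht.1.le, ht.2⟩
    rw [norm_mul, hnp, one_mul]
    refine (norm_sub_le _ _).trans (add_le_add ?_ ?_)
    · rw [norm_div]
      exact div_le_div₀ hK₁0 (hK₁ t ht') (by positivity) (hden t ht')
    · rw [norm_div, norm_mul, Complex.norm_real, Real.norm_of_nonneg (by positivity)]
      exact div_le_div₀ (by positivity)
        (mul_le_mul_of_nonneg_right (hK₀ t ht') (by positivity)) (by positivity) (hden2 t ht')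
  -- The two endpoints contribute `2K₀`, and the derivative of the denominator at most one more `K₀`
  -- since `4R(b - a) ≤ |w|`. The resulting `3K₀ + (b - a)K₁` is absorbed by the factor `1/π`, as `π
  -- > 3`.
  have hfin : K₀ / (Real.pi * |w|) + K₀ / (Real.pi * |w|) +
      (K₁ / (Real.pi * |w|) + K₀ * (2 * R) / (Real.pi * |w| ^ 2 / 2)) * |b - a|
      ≤ (K₀ + (b - a) * K₁) / |w| := by
    rw [abs_of_nonneg (sub_nonneg.2 hab)]
    have e1 : K₀ / (Real.pi * |w|) + K₀ / (Real.pi * |w|) +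
      (K₁ / (Real.pi * |w|) + K₀ * (2 * R) / (Real.pi * |w| ^ 2 / 2)) * (b - a)
      = (2 * K₀ + (b - a) * K₁ + K₀ * (4 * R * (b - a)) / |w|) / Real.pi / |w| := by
      field_simp
      ring
    rw [e1]
    refine div_le_div_of_nonneg_right ?_ hwp.le
    rw [div_le_iff₀ Real.pi_pos]
    have e2 : K₀ * (4 * R * (b - a)) / |w| ≤ K₀ := by
      rw [div_le_iff₀ hwp]; exact mul_le_mul_of_nonneg_left hw hK₀0
    have e3 : 0 ≤ (b - a) * K₁ := mul_nonneg (sub_nonneg.2 hab) hK₁0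
    nlinarith
  refine le_trans ((norm_sub_le _ _).trans (add_le_add ((norm_sub_le _ _).trans
    (add_le_add (hbd b ⟨hab, le_rfl⟩) (hbd a ⟨le_rfl, hab⟩))) hin)) hfin

/-! ### Concatenated chirps -/

/-- The chirp of rate `R j` restricted to the interval `[a j, a (j + 1))`. -/
noncomputable def chirpPiece (a R : ℕ → ℝ) (j : ℕ) : ℝ → ℂ :=
  (Set.Ico (a j) (a (j + 1))).indicator (chirp (R j) (a j))

/-- The concatenation of the chirps of rate `R j` on the consecutive intervals
`[a j, a (j + 1))`. -/
noncomputable def chirpTrain (a R : ℕ → ℝ) (t : ℝ) : ℂ := ∑' j, chirpPiece a R j t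

section

variable {a R : ℕ → ℝ}

theorem measurable_chirpPiece (j : ℕ) : Measurable (chirpPiece a R j) :=
  (continuous_chirp _ _).measurable.indicator measurableSet_Ico

theorem norm_chirpPiece (j : ℕ) (t : ℝ) :
    ‖chirpPiece a R j t‖ = (Set.Ico (a j) (a (j + 1))).indicator (fun _ => 1) t := by
  rw [chirpPiece, norm_indicator_eq_indicator_norm]
  simp only [norm_chirp]

theorem memLp_chirpPiece (j : ℕ) (p : ℝ≥0∞) : MemLp (chirpPiece a R j) p :=
  (memLp_indicator_iff_restrict measurableSet_Ico).2
    (MemLp.of_bound (continuous_chirp _ _).aestronglyMeasurable 1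
      (Eventually.of_forall fun t => (norm_chirp _ _ t).le))

theorem chirpPiece_eq_zero (ha : Monotone a) {i j : ℕ} (hij : i ≠ j) {t : ℝ}
    (ht : t ∈ Set.Ico (a j) (a (j + 1))) : chirpPiece a R i t = 0 :=
  Set.indicator_of_notMem
    (fun h => (Set.disjoint_left.1 (ha.pairwise_disjoint_on_Ico_succ hij)) h ht) _

theorem hasSum_chirpPiece (ha : Monotone a) (t : ℝ) :
    HasSum (fun j => chirpPiece a R j t) (chirpTrain a R t) := by
  refine Summable.hasSum ?_
  by_cases h : ∃ j, t ∈ Set.Ico (a j) (a (j + 1))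
  · obtain ⟨j, hj⟩ := h
    exact (hasSum_single j fun i hi => chirpPiece_eq_zero ha hi hj).summable
  · push Not at h
    simpa only [chirpPiece, Set.indicator_of_notMem (h _)] using summable_zero

theorem chirpTrain_of_mem (ha : Monotone a) {j : ℕ} {t : ℝ}
    (ht : t ∈ Set.Ico (a j) (a (j + 1))) : chirpTrain a R t = chirp (R j) (a j) t := by
  rw [chirpTrain, tsum_eq_single j fun i hi => chirpPiece_eq_zero ha hi ht, chirpPiece,
    Set.indicator_of_mem ht]

theorem measurable_chirpTrain (ha : Monotone a) : Measurable (chirpTrain a R) := by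
  refine measurable_of_tendsto_metrizable
    (f := fun n t => ∑ j ∈ Finset.range n, chirpPiece a R j t)
    (fun n => Finset.measurable_fun_sum _ fun j _ => measurable_chirpPiece j) ?_
  exact tendsto_pi_nhds.2 fun t => (hasSum_chirpPiece ha t).tendsto_sum_nat

theorem norm_chirpTrain {α : ℝ} (ha : Monotone a) (hlt : ∀ j, a j < α)
    (hlim : Tendsto a atTop (𝓝 α)) (t : ℝ) :
    ‖chirpTrain a R t‖ = (Set.Ico (a 0) α).indicator (fun _ => 1) t := by
  by_cases h : t ∈ Set.Ico (a 0) α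
  · rw [Set.indicator_of_mem h]
    have hex : ∃ n, t < a n := (hlim.eventually (lt_mem_nhds h.2)).exists
    obtain ⟨j, hj⟩ : ∃ j, Nat.find hex = j + 1 := Nat.exists_eq_succ_of_ne_zero fun h0 => by
      have := Nat.find_spec hex
      rw [h0] at this
      exact absurd h.1 (not_le.2 this)
    have h1 : t < a (j + 1) := hj ▸ Nat.find_spec hex
    have h2 : a j ≤ t := not_lt.1 (Nat.find_min hex (by omega))
    rw [chirpTrain_of_mem ha ⟨h2, h1⟩, norm_chirp]
  · rw [Set.indicator_of_notMem h, norm_eq_zero, chirpTrain]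
    have : ∀ j, chirpPiece a R j t = 0 := fun j => Set.indicator_of_notMem
      (fun hj => h ⟨(ha (Nat.zero_le j)).trans hj.1, hj.2.trans (hlt _)⟩) _
    simp [this]

theorem fourier_chirpPiece_mul (j : ℕ) (haj : a j ≤ a (j + 1)) (A : ℝ → ℂ) (w : ℝ) :
    𝓕 (fun t => chirpPiece a R j t * A t) w
      = ∫ t in (a j)..(a (j + 1)), chirp (R j) (a j) t * phase (-w) t * A t := by
  rw [Real.fourier_eq', intervalIntegral.integral_of_le haj, ← integral_Ico_eq_integral_Ioc,
    ← integral_indicator measurableSet_Ico]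
  congr 1
  funext t
  by_cases ht : t ∈ Set.Ico (a j) (a (j + 1))
  · rw [Set.indicator_of_mem ht, chirpPiece, Set.indicator_of_mem ht]
    have : Complex.exp (((-2 * Real.pi * inner ℝ t w : ℝ) : ℂ) * Complex.I) = phase (-w) t := by
      unfold phase; congr 1; simp; ring
    rw [this, smul_eq_mul]; ring
  · rw [Set.indicator_of_notMem ht, chirpPiece, Set.indicator_of_notMem ht]
    simp

theorem norm_fourier_chirpPiece_le (j : ℕ) (haj : a j ≤ a (j + 1)) (hR : 0 < R j) (w : ℝ) :
    ‖𝓕 (chirpPiece a R j) w‖ ≤ 4 / Real.sqrt (R j) := by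
  have h := fourier_chirpPiece_mul (R := R) j haj (fun _ => 1) w
  simp only [mul_one] at h
  rw [show 𝓕 (chirpPiece a R j) w = _ from h]
  exact norm_integral_chirp_mul_phase_le hR _ _ _ _

theorem lintegral_enorm_chirpPiece_sq (j : ℕ) :
    ∫⁻ t, ‖chirpPiece a R j t‖ₑ ^ (2 : ℝ) = ENNReal.ofReal (a (j + 1) - a j) := by
  have : ∀ t, ‖chirpPiece a R j t‖ₑ ^ (2 : ℝ)
      = (Set.Ico (a j) (a (j + 1))).indicator (fun _ => 1) t := fun t => by
    rw [← ofReal_norm, norm_chirpPiece]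
    by_cases ht : t ∈ Set.Ico (a j) (a (j + 1)) <;> simp [ht]
  simp only [this]
  rw [lintegral_indicator measurableSet_Ico]
  simp

end

/-! ### The short-time Fourier transform and mixed norms -/

theorem stft_toLp_eq_fourier (ψ : 𝓢(ℝ, ℂ)) {g₀ : ℝ → ℂ} (hL : MemLp g₀ 2) (x w : ℝ) :
    stft ψ (hL.toLp g₀ : 𝓢'(ℝ, ℂ)) x w
      = 𝓕 (fun t => g₀ t * (starRingEnd ℂ) (ψ (t - x))) w := by
  rw [stft_L2, Real.fourier_eq']
  refine integral_congr_ae ?_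
  filter_upwards [hL.coeFn_toLp] with t ht
  have : Complex.exp (((-2 * Real.pi * inner ℝ t w : ℝ) : ℂ) * Complex.I) = phase (-w) t := by
    unfold phase; congr 1; simp; ring
  rw [ht, this, map_mul, conj_phase, smul_eq_mul]; ring

theorem measurable_fourier_mul_window {u : ℝ → ℂ} (hu : Measurable u) (ψ : 𝓢(ℝ, ℂ)) :
    Measurable fun z : ℝ × ℝ => 𝓕 (fun t => u t * (starRingEnd ℂ) (ψ (t - z.1))) z.2 := by
  simp only [Real.fourier_eq']
  refine StronglyMeasurable.measurable (StronglyMeasurable.integral_prod_right'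
    (f := fun y : (ℝ × ℝ) × ℝ => Complex.exp (((-2 * Real.pi * inner ℝ y.2 y.1.2 : ℝ) : ℂ) *
      Complex.I) • (u y.2 * (starRingEnd ℂ) (ψ (y.2 - y.1.1)))) ?_)
  refine Measurable.stronglyMeasurable (Measurable.fun_smul ?_ (Measurable.fun_mul ?_ ?_))
  · exact Continuous.measurable (by fun_prop)
  · exact hu.comp measurable_snd
  · exact Continuous.measurable (Complex.continuous_conj.comp (ψ.continuous.comp (by fun_prop)))

/-- With equal exponents the mixed norm is a double integral, and Tonelli makes `w` the inner
variable, so that each window position `x` can be treated separately. -/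
theorem mixedNorm_lt_top_iff {F : ℝ → ℝ → ℂ} (hF : Measurable (Function.uncurry F)) {p : ℝ}
    (hp : 0 < p) :
    mixedNorm (ENNReal.ofReal p) (ENNReal.ofReal p) F < ⊤ ↔
      ∫⁻ x, ∫⁻ w, ‖F x w‖ₑ ^ p < ⊤ := by
  have h0 : ENNReal.ofReal p ≠ 0 := by simpa using hp
  rw [mixedNorm, eLpNorm_lt_top_iff_lintegral_rpow_enorm_lt_top h0 ENNReal.ofReal_ne_top]
  simp only [eLpNorm_eq_lintegral_rpow_enorm_toReal h0 ENNReal.ofReal_ne_top,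
    ENNReal.toReal_ofReal hp.le, enorm_eq_self, one_div, ENNReal.rpow_inv_rpow hp.ne']
  rw [lintegral_lintegral_swap]
  exact ((hF.comp measurable_swap).enorm.pow_const p).aemeasurable

theorem toLp_mem_modulationSpace_iff {u : ℝ → ℂ} (hu : Measurable u) (hL : MemLp u 2)
    (ψ : 𝓢(ℝ, ℂ)) {p : ℝ} (hp : 0 < p) :
    (hL.toLp u : 𝓢'(ℝ, ℂ)) ∈ modulationSpace ψ (ENNReal.ofReal p) (ENNReal.ofReal p) ↔
      ∫⁻ x, ∫⁻ w, ‖𝓕 (fun t => u t * (starRingEnd ℂ) (ψ (t - x))) w‖ₑ ^ p < ⊤ := by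
  have hst : stft ψ (hL.toLp u : 𝓢'(ℝ, ℂ)) = fun x w =>
      𝓕 (fun t => u t * (starRingEnd ℂ) (ψ (t - x))) w := by
    funext x w; exact stft_toLp_eq_fourier ψ hL x w
  change mixedNorm _ _ _ < ⊤ ↔ _
  rw [hst]
  exact mixedNorm_lt_top_iff (F := fun x w => 𝓕 (fun t => u t * (starRingEnd ℂ) (ψ (t - x))) w)
    (measurable_fourier_mul_window hu ψ) hp

/-! ### Lower bounds for Fourier transforms in `L^p`, `p < 2` -/

/-- A pointwise substitute for Hölder's inequality. If `v ≤ τh`, the first term suffices; otherwise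
`h = h^(p-1) h^(2-p)` with `h < v/τ` in the first factor and `h ≤ M` in the second gives the other
term. -/
theorem mul_le_add_of_le {p τ M v h : ℝ} (hp : 1 ≤ p) (hp2 : p ≤ 2) (hτ : 0 < τ) (hv : 0 ≤ v)
    (hh : 0 ≤ h) (hM : h ≤ M) :
    v * h ≤ τ * h ^ (2 : ℝ) + τ ^ (1 - p) * M ^ (2 - p) * v ^ p := by
  have hM0 : 0 ≤ M := hh.trans hM
  rcases le_or_gt v (τ * h) with hc | hc
  · have h1 : v * h ≤ τ * h ^ (2 : ℝ) := by
      rw [Real.rpow_two]; nlinarith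
    have h2 : 0 ≤ τ ^ (1 - p) * M ^ (2 - p) * v ^ p := by positivity
    linarith
  · have hv0 : 0 < v := lt_of_le_of_lt (by positivity) hc
    have h2 : v * h ≤ τ ^ (1 - p) * M ^ (2 - p) * v ^ p := by
      have e1 : h = h ^ (p - 1) * h ^ (2 - p) := by
        rcases hh.eq_or_lt with h0 | h0
        · subst h0
          -- Since `0 ^ 0 = 1`, a nonzero exponent has to be found; `p - 1` and `2 - p` add up to
          -- `1`, so one of them is nonzero.
          rcases eq_or_ne (2 - p) 0 with hz | hz
          · have : p - 1 ≠ 0 := by intro h; linarith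
            rw [Real.zero_rpow this, zero_mul]
          · rw [Real.zero_rpow hz, mul_zero]
        · rw [← Real.rpow_add h0]; ring_nf; rw [Real.rpow_one]
      have e2 : v ^ p = v * v ^ (p - 1) := by
        rw [← Real.rpow_one_add' hv (by linarith)]; ring_nf
      have e3 : h ^ (p - 1) ≤ τ ^ (1 - p) * v ^ (p - 1) := by
        have : h ≤ τ⁻¹ * v := by rw [← div_eq_inv_mul, le_div_iff₀ hτ]; linarith
        have := Real.rpow_le_rpow hh this (by linarith : 0 ≤ p - 1)
        rwa [Real.mul_rpow (inv_pos.2 hτ).le hv, Real.inv_rpow hτ.le, ← Real.rpow_neg hτ.le,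
          neg_sub] at this
      have e4 : h ^ (2 - p) ≤ M ^ (2 - p) := Real.rpow_le_rpow hh hM (by linarith)
      calc v * h = v * (h ^ (p - 1) * h ^ (2 - p)) := by rw [← e1]
        _ ≤ v * ((τ ^ (1 - p) * v ^ (p - 1)) * M ^ (2 - p)) := by gcongr
        _ = _ := by rw [e2]; ring
    have h1 : 0 ≤ τ * h ^ (2 : ℝ) := by positivity
    linarith

/-- Testing against `h` with small `‖𝓕 h‖_∞` bounds `‖𝓕 f‖_p` from below. -/
theorem enorm_integral_mul_conj_le {f h : ℝ → ℂ} (hf₁ : Integrable f) (hf₂ : MemLp f 2)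
    (hh₁ : Integrable h) (hh₂ : MemLp h 2) {p τ M : ℝ} (hp : 1 ≤ p) (hp2 : p ≤ 2) (hτ : 0 < τ)
    (hM : ∀ w, ‖𝓕 h w‖ ≤ M) :
    ‖∫ t, f t * (starRingEnd ℂ) (h t)‖ₑ ≤ ENNReal.ofReal τ * (∫⁻ t, ‖h t‖ₑ ^ (2 : ℝ)) +
      ENNReal.ofReal (τ ^ (1 - p) * M ^ (2 - p)) * ∫⁻ w, ‖𝓕 f w‖ₑ ^ p := by
  have hM0 : 0 ≤ M := (norm_nonneg _).trans (hM 0)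
  -- Plancherel moves both the pairing and the `L²` norm of `h` to the frequency side, where the
  -- pointwise inequality is integrated.
  rw [← integral_conj_fourier_mul_fourier hh₁ hh₂ hf₁ hf₂, ← lintegral_enorm_fourier_sq hh₁ hh₂,
    ← lintegral_const_mul' _ _ ENNReal.ofReal_ne_top,
    ← lintegral_const_mul' _ _ ENNReal.ofReal_ne_top]
  have hmeas := (memLp_fourier hh₁ hh₂).aestronglyMeasurable.enorm.pow_const (2 : ℝ)
  rw [← lintegral_add_left' (hmeas.const_mul _)]
  refine (enorm_integral_le_lintegral_enorm _).trans (lintegral_mono fun w => ?_)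
  have := mul_le_add_of_le hp hp2 hτ (norm_nonneg (𝓕 f w)) (norm_nonneg (𝓕 h w)) (hM w)
  simp only [← ofReal_norm, norm_mul, RCLike.norm_conj]
  rw [ENNReal.ofReal_rpow_of_nonneg (norm_nonneg _) (by norm_num),
    ENNReal.ofReal_rpow_of_nonneg (norm_nonneg _) (by linarith),
    ← ENNReal.ofReal_mul hτ.le,
    ← ENNReal.ofReal_mul (by positivity), ← ENNReal.ofReal_add (by positivity) (by positivity)]
  exact ENNReal.ofReal_le_ofReal this

/-! ### Concatenated chirps outside `M^p` -/

theorem memLp_mul_window {u : ℝ → ℂ} {p : ℝ≥0∞} (hu : MemLp u p) (ψ : 𝓢(ℝ, ℂ)) (x : ℝ) :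
    MemLp (fun t => u t * (starRingEnd ℂ) (ψ (t - x))) p := by
  refine hu.of_le_mul (c := SchwartzMap.seminorm ℝ 0 0 ψ)
    (hu.aestronglyMeasurable.mul (Continuous.aestronglyMeasurable
      (Complex.continuous_conj.comp (ψ.continuous.comp (by fun_prop)))))
    (Eventually.of_forall fun t => ?_)
  rw [norm_mul, RCLike.norm_conj, mul_comm]
  exact mul_le_mul_of_nonneg_right (ψ.norm_le_seminorm ℝ _) (norm_nonneg _)

variable {a R : ℕ → ℝ} {α : ℝ}

theorem memLp_chirpTrain (ha : Monotone a) (hlt : ∀ j, a j < α)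
    (hlim : Tendsto a atTop (𝓝 α)) (p : ℝ≥0∞) : MemLp (chirpTrain a R) p := by
  have h1 : MemLp ((Set.Ico (a 0) α).indicator fun _ => (1 : ℝ)) p :=
    memLp_indicator_const p measurableSet_Ico 1 (Or.inr (by simp))
  refine h1.of_le (measurable_chirpTrain ha).aestronglyMeasurable (Eventually.of_forall fun t => ?_)
  rw [norm_chirpTrain ha hlt hlim]
  exact le_abs_self _

/-- The intervals accumulate at `α`, so by continuity the window on a late interval differs from its
value at `α` by at most half the modulus of that value, and no cancellation can occur. -/
theorem integral_window_ge {ψ : 𝓢(ℝ, ℂ)} {x : ℝ} (hψ : ψ (α - x) ≠ 0) (ha : Monotone a)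
    (hlt : ∀ j, a j < α) (hlim : Tendsto a atTop (𝓝 α)) :
    ∀ᶠ j in atTop, (a (j + 1) - a j) * (‖ψ (α - x)‖ / 2) ≤
      ‖∫ t in (a j)..(a (j + 1)), (starRingEnd ℂ) (ψ (t - x))‖ := by
  set z := (starRingEnd ℂ) (ψ (α - x)) with hz
  have hzn : ‖z‖ = ‖ψ (α - x)‖ := RCLike.norm_conj _
  have hcont : Continuous fun t => (starRingEnd ℂ) (ψ (t - x)) :=
    Complex.continuous_conj.comp (ψ.continuous.comp (by fun_prop))
  have hpos : 0 < ‖z‖ / 2 := by rw [hzn]; exact half_pos (norm_pos_iff.2 hψ)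
  obtain ⟨δ, hδ, hball⟩ := Metric.continuousAt_iff.1 (hcont.continuousAt (x := α)) _ hpos
  filter_upwards [hlim.eventually (lt_mem_nhds (sub_lt_self α hδ))] with j hj
  have hle : a j ≤ a (j + 1) := ha (Nat.le_succ j)
  have hb : ‖∫ t in (a j)..(a (j + 1)), ((starRingEnd ℂ) (ψ (t - x)) - z)‖
      ≤ ‖z‖ / 2 * |a (j + 1) - a j| := by
    refine intervalIntegral.norm_integral_le_of_norm_le_const fun t ht => ?_
    rw [Set.uIoc_of_le hle] at ht
    have h1 := hlt (j + 1)
    have : dist t α < δ := by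
      rw [Real.dist_eq, abs_lt]; constructor <;> linarith [ht.1, ht.2]
    have := hball this
    rw [dist_eq_norm] at this
    exact this.le
  rw [intervalIntegral.integral_sub (hcont.intervalIntegrable _ _) intervalIntegrable_const,
    intervalIntegral.integral_const, abs_of_nonneg (sub_nonneg.2 hle)] at hb
  have h2 := norm_sub_norm_le ((a (j + 1) - a j) • z)
    (∫ t in (a j)..(a (j + 1)), (starRingEnd ℂ) (ψ (t - x)))
  rw [norm_sub_rev, norm_smul, Real.norm_of_nonneg (sub_nonneg.2 hle)] at h2
  rw [← hzn]
  linarith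

/-- Testing against the `j`-th chirp removes the oscillation on its interval and leaves a pairing of
order `ℓ j`. Because the transform of that chirp is at most `4/√(R j)`, a finite `L^p` integral
would bound `ℓ j * R j ^ (1 - p/2)` uniformly in `j`. -/
theorem lintegral_fourier_chirpTrain_eq_top {ψ : 𝓢(ℝ, ℂ)} {x c p : ℝ} (hψ : ψ (α - x) ≠ 0)
    (hc : 0 < c) (hp : 1 ≤ p) (hp2 : p ≤ 2) (ha : Monotone a) (hlt : ∀ j, a j < α)
    (hlim : Tendsto a atTop (𝓝 α)) (hR : ∀ j, 0 < R j)
    (hgrow : Tendsto (fun j => (a (j + 1) - a j) * R j ^ (1 - p / 2)) atTop atTop) :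
    ∫⁻ w, ‖𝓕 (fun t => c * chirpTrain a R t * (starRingEnd ℂ) (ψ (t - x))) w‖ₑ ^ p = ⊤ := by
  by_contra hfin
  set N := ∫⁻ w, ‖𝓕 (fun t => c * chirpTrain a R t * (starRingEnd ℂ) (ψ (t - x))) w‖ₑ ^ p
  have hu : ∀ r : ℝ≥0∞, MemLp (fun t => (c : ℂ) * chirpTrain a R t) r := fun r =>
    (memLp_chirpTrain ha hlt hlim r).const_mul _
  have hf := fun r => memLp_mul_window (hu r) ψ x
  set m := ‖ψ (α - x)‖
  have hm : 0 < m := norm_pos_iff.2 hψ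
  -- The pairing is at least `c ℓ m / 2`, so with this `τ` the term `τ ℓ` is half of that bound and
  -- can be absorbed.
  set τ := c * m / 4 with hτdef
  have hτ : 0 < τ := by positivity
  have key : ∀ᶠ j in atTop, τ * ((a (j + 1) - a j) * R j ^ (1 - p / 2)) ≤
      τ ^ (1 - p) * 4 ^ (2 - p) * N.toReal := by
    filter_upwards [integral_window_ge hψ ha hlt hlim] with j hj
    have hle : a j ≤ a (j + 1) := ha (Nat.le_succ j)
    have hl0 := sub_nonneg.2 hle
    have hRj := hR j
    have h := enorm_integral_mul_conj_le (memLp_one_iff_integrable.1 (hf 1)) (hf 2)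
      (memLp_one_iff_integrable.1 (memLp_chirpPiece (a := a) (R := R) j 1)) (memLp_chirpPiece j 2)
      hp hp2 hτ (norm_fourier_chirpPiece_le j hle hRj)
    rw [lintegral_enorm_chirpPiece_sq] at h
    have hinteg : ∫ t, c * chirpTrain a R t * (starRingEnd ℂ) (ψ (t - x)) *
        (starRingEnd ℂ) (chirpPiece a R j t)
        = c * ∫ t in (a j)..(a (j + 1)), (starRingEnd ℂ) (ψ (t - x)) := by
      rw [intervalIntegral.integral_of_le hle, ← integral_Ico_eq_integral_Ioc,
        ← integral_indicator measurableSet_Ico, ← integral_const_mul]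
      congr 1
      funext t
      by_cases ht : t ∈ Set.Ico (a j) (a (j + 1))
      · rw [Set.indicator_of_mem ht, chirpPiece, Set.indicator_of_mem ht, chirpTrain_of_mem ha ht]
        have h1 : chirp (R j) (a j) t * (starRingEnd ℂ) (chirp (R j) (a j) t) = 1 := by
          rw [Complex.mul_conj']; simp [norm_chirp]
        linear_combination (c * (starRingEnd ℂ) (ψ (t - x))) * h1
      · rw [Set.indicator_of_notMem ht, chirpPiece, Set.indicator_of_notMem ht]
        simp
    have hN : N = ENNReal.ofReal N.toReal := (ENNReal.ofReal_toReal hfin).symm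
    change _ ≤ _ + _ * N at h
    rw [hinteg, ← ofReal_norm, hN, ← ENNReal.ofReal_mul hτ.le, ← ENNReal.ofReal_mul (by positivity),
      ← ENNReal.ofReal_add (by positivity) (by positivity),
      ENNReal.ofReal_le_ofReal_iff (by positivity), norm_mul, Complex.norm_real,
      Real.norm_of_nonneg hc.le] at h
    have h1 : τ * (a (j + 1) - a j) ≤
        τ ^ (1 - p) * (4 / Real.sqrt (R j)) ^ (2 - p) * N.toReal := by
      have := mul_le_mul_of_nonneg_left hj hc.le
      have e : c * ((a (j + 1) - a j) * (m / 2)) = 2 * (τ * (a (j + 1) - a j)) := by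
        rw [hτdef]; ring
      linarith
    have h2 : (4 / Real.sqrt (R j)) ^ (2 - p) * R j ^ (1 - p / 2) = 4 ^ (2 - p) := by
      rw [Real.div_rpow (by norm_num) (Real.sqrt_nonneg _), Real.sqrt_eq_rpow,
        ← Real.rpow_mul hRj.le, show 1 / 2 * (2 - p) = 1 - p / 2 by ring]
      have := (Real.rpow_pos_of_pos hRj (1 - p / 2)).ne'
      field_simp
    have h3 := mul_le_mul_of_nonneg_right h1 (Real.rpow_pos_of_pos hRj (1 - p / 2)).le
    calc _ = τ * (a (j + 1) - a j) * R j ^ (1 - p / 2) := by ring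
      _ ≤ _ := h3
      _ = τ ^ (1 - p) * ((4 / Real.sqrt (R j)) ^ (2 - p) * R j ^ (1 - p / 2)) * N.toReal := by ring
      _ = _ := by rw [h2]
  obtain ⟨j, h1, h2⟩ := (key.and ((hgrow.const_mul_atTop hτ).eventually_gt_atTop
    (τ ^ (1 - p) * 4 ^ (2 - p) * N.toReal))).exists
  linarith

/-- The inner integral is infinite for every `x` with `ψ (α - x) ≠ 0`; these `x` form a nonempty
open set, which has positive measure. -/
theorem chirpTrain_notMem_modulationSpace {c p : ℝ} (hc : 0 < c) (hp : 1 ≤ p) (hp2 : p ≤ 2)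
    (ha : Monotone a) (hlt : ∀ j, a j < α) (hlim : Tendsto a atTop (𝓝 α)) (hR : ∀ j, 0 < R j)
    (hgrow : Tendsto (fun j => (a (j + 1) - a j) * R j ^ (1 - p / 2)) atTop atTop)
    (hL : MemLp (fun t => (c : ℂ) * chirpTrain a R t) 2) {ψ : 𝓢(ℝ, ℂ)} (hψ : ψ ≠ 0) :
    (hL.toLp _ : 𝓢'(ℝ, ℂ)) ∉ modulationSpace ψ (ENNReal.ofReal p) (ENNReal.ofReal p) := by
  have hmeas : Measurable fun t => (c : ℂ) * chirpTrain a R t :=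
    (measurable_chirpTrain ha).const_mul _
  rw [toLp_mem_modulationSpace_iff hmeas hL ψ (by linarith)]
  intro hfin
  have hae := ae_lt_top
    (Measurable.lintegral_prod_right' (f := fun z : ℝ × ℝ =>
      ‖𝓕 (fun t => c * chirpTrain a R t * (starRingEnd ℂ) (ψ (t - z.1))) z.2‖ₑ ^ p)
      ((measurable_fourier_mul_window hmeas ψ).enorm.pow_const p)) hfin.ne
  obtain ⟨s, hs⟩ : ∃ s, ψ s ≠ 0 := by
    by_contra! h
    exact hψ (SchwartzMap.ext h)
  have hopen : IsOpen {x : ℝ | ψ (α - x) ≠ 0} :=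
    isOpen_ne_fun (ψ.continuous.comp (by fun_prop)) continuous_const
  have hpos := hopen.measure_pos volume ⟨α - s, by simpa using hs⟩
  refine hpos.ne' (measure_mono_null (fun x hx => ?_) (ae_iff.1 hae))
  simp only [Set.mem_ofPred_eq, not_lt, top_le_iff]
  exact lintegral_fourier_chirpTrain_eq_top hx hc hp hp2 ha hlt hlim hR hgrow

/-! ### Concatenated chirps in `M^q` -/

theorem lintegral_Ioi_rpow {q L C : ℝ} (hq : 1 < q) (hL : 0 < L) (hC : 0 ≤ C) :
    ∫⁻ w in Set.Ioi L, ENNReal.ofReal (C * w ^ (-q))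
      = ENNReal.ofReal (C * (L ^ (1 - q) / (q - 1))) := by
  have hinteg := (integrableOn_Ioi_rpow_of_lt (by linarith : -q < -1) hL).const_mul C
  rw [← ofReal_integral_eq_lintegral_ofReal hinteg]
  · rw [integral_const_mul, integral_Ioi_rpow_of_lt (by linarith : -q < -1) hL]
    congr 2
    rw [show -q + 1 = 1 - q by ring, show (1 - q) = -(q - 1) by ring, neg_div_neg_eq]
  · refine (ae_restrict_iff' measurableSet_Ioi).2 (Eventually.of_forall fun w hw => ?_)
    have : 0 < w := hL.trans hw
    simp only [Pi.zero_apply]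
    positivity

theorem lintegral_Iio_neg_rpow {q L C : ℝ} (hq : 1 < q) (hL : 0 < L) (hC : 0 ≤ C) :
    ∫⁻ w in Set.Iio (-L), ENNReal.ofReal (C * (-w) ^ (-q))
      = ENNReal.ofReal (C * (L ^ (1 - q) / (q - 1))) := by
  rw [← lintegral_Ioi_rpow hq hL hC,
    ← (Measure.measurePreserving_neg (volume : Measure ℝ)).setLIntegral_comp_preimage_emb
      (Homeomorph.neg ℝ).measurableEmbedding (fun w => ENNReal.ofReal (C * w ^ (-q))) (Set.Ioi L)]
  congr 2
  ext w
  simp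

/-- Above the level `τ`, `v^(q-2) ≤ τ^(q-2)`; below it, `v^q ≤ τ^q`. On a set of finite measure this
controls an `L^q` integral by the `L²` integral and the measure. -/
theorem rpow_le_add_rpow {q τ v : ℝ} (hq : 0 ≤ q) (hq2 : q ≤ 2) (hτ : 0 < τ) (hv : 0 ≤ v) :
    v ^ q ≤ τ ^ (q - 2) * v ^ (2 : ℝ) + τ ^ q := by
  rcases le_total v τ with h | h
  · have h1 := Real.rpow_le_rpow hv h hq
    have h2 : 0 ≤ τ ^ (q - 2) * v ^ (2 : ℝ) := by positivity
    linarith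
  · have hv0 : 0 < v := hτ.trans_le h
    have h1 : v ^ (q - 2) ≤ τ ^ (q - 2) := Real.rpow_le_rpow_of_nonpos hτ h (by linarith)
    have h2 : v ^ q = v ^ (q - 2) * v ^ (2 : ℝ) := by
      rw [← Real.rpow_add hv0]; ring_nf
    have h3 : 0 ≤ τ ^ q := by positivity
    rw [h2]
    have := mul_le_mul_of_nonneg_right h1 (by positivity : 0 ≤ v ^ (2 : ℝ))
    linarith

/-- A function with `L²` norm at most `K √ℓ` which decays like `K / |w|` off the band
`|w| ≤ 4 R ℓ` has controlled `L^q` norm. -/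
theorem lintegral_rpow_le_of_band {F : ℝ → ℂ} (hF : AEStronglyMeasurable F volume)
    {q K R ℓ : ℝ} (hq : 1 < q) (hq2 : q ≤ 2) (hK : 0 < K) (hR : 0 < R) (hℓ : 0 < ℓ)
    (hsq : ∫⁻ w, ‖F w‖ₑ ^ (2 : ℝ) ≤ ENNReal.ofReal (K ^ 2 * ℓ))
    (hdecay : ∀ w, 4 * R * ℓ ≤ |w| → w ≠ 0 → ‖F w‖ ≤ K / |w|) :
    ∫⁻ w, ‖F w‖ₑ ^ q ≤ ENNReal.ofReal
      (K ^ q * (9 * (R ^ (1 - q / 2) * ℓ) + 2 * ((4 * R * ℓ) ^ (1 - q) / (q - 1)))) := by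
  set L := 4 * R * ℓ with hLdef
  have hL : 0 < L := by positivity
  -- This is the expected size of `F` on the band. It makes the `L²` term and the band-length term
  -- multiples of the same `K^q R^(1-q/2) ℓ`, with factors `1` and `8`, hence the constant `9`.
  set τ := K * R ^ (-(1 / 2) : ℝ) with hτdef
  have hτ : 0 < τ := by positivity
  have hq1 : 0 < q - 1 := by linarith
  have hpt : ∀ w, ‖F w‖ₑ ^ q ≤ ENNReal.ofReal (τ ^ (q - 2)) * ‖F w‖ₑ ^ (2 : ℝ) +
      ((Set.Icc (-L) L).indicator (fun _ => ENNReal.ofReal (τ ^ q)) w +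
      ((Set.Ioi L).indicator (fun w => ENNReal.ofReal (K ^ q * w ^ (-q))) w +
      (Set.Iio (-L)).indicator (fun w => ENNReal.ofReal (K ^ q * (-w) ^ (-q))) w)) := fun w => by
    have hfar : L < |w| → ‖F w‖ₑ ^ q ≤ ENNReal.ofReal (K ^ q * |w| ^ (-q)) := fun hw => by
      have hw0 : 0 < |w| := hL.trans hw
      rw [← ofReal_norm, ENNReal.ofReal_rpow_of_nonneg (norm_nonneg _) (by linarith)]
      refine ENNReal.ofReal_le_ofReal ?_
      refine (Real.rpow_le_rpow (norm_nonneg _) (hdecay w hw.le (abs_pos.1 hw0))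
        (by linarith)).trans (le_of_eq ?_)
      rw [Real.div_rpow hK.le hw0.le, Real.rpow_neg hw0.le, div_eq_mul_inv]
    rcases lt_or_ge L w with h1 | h1
    · have h := hfar (h1.trans_le (le_abs_self w))
      rw [abs_of_pos (hL.trans h1)] at h
      rw [Set.indicator_of_mem (show w ∈ Set.Ioi L from h1)]
      exact h.trans (le_add_left (le_add_left (le_add_right le_rfl)))
    rcases lt_or_ge w (-L) with h2 | h2
    · have hw : w < 0 := by linarith
      have h := hfar (by rw [abs_of_neg hw]; linarith)
      rw [abs_of_neg hw] at h
      rw [Set.indicator_of_mem (show w ∈ Set.Iio (-L) from h2)]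
      exact h.trans (le_add_left (le_add_left (le_add_left le_rfl)))
    · rw [Set.indicator_of_mem (show w ∈ Set.Icc (-L) L from ⟨h2, h1⟩), ← add_assoc]
      refine le_add_right ?_
      rw [← ofReal_norm, ENNReal.ofReal_rpow_of_nonneg (norm_nonneg _) (by linarith),
        ENNReal.ofReal_rpow_of_nonneg (norm_nonneg _) (by norm_num),
        ← ENNReal.ofReal_mul (by positivity), ← ENNReal.ofReal_add (by positivity) (by positivity)]
      exact ENNReal.ofReal_le_ofReal (rpow_le_add_rpow (by linarith) hq2 hτ (norm_nonneg _))
  have hm1 : Measurable ((Set.Icc (-L) L).indicator fun _ => ENNReal.ofReal (τ ^ q)) :=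
    measurable_const.indicator measurableSet_Icc
  have hm2 : Measurable ((Set.Ioi L).indicator fun w => ENNReal.ofReal (K ^ q * w ^ (-q))) :=
    Measurable.indicator (by fun_prop) measurableSet_Ioi
  refine (lintegral_mono hpt).trans ?_
  rw [lintegral_add_left' ((hF.enorm.pow_const _).const_mul _), lintegral_add_left hm1,
    lintegral_add_left hm2, lintegral_const_mul' _ _ ENNReal.ofReal_ne_top,
    lintegral_indicator measurableSet_Icc, lintegral_indicator measurableSet_Ioi,
    lintegral_indicator measurableSet_Iio, lintegral_Ioi_rpow hq hL (by positivity),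
    lintegral_Iio_neg_rpow hq hL (by positivity), setLIntegral_const, Real.volume_Icc,
    sub_neg_eq_add]
  refine (add_le_add_left (mul_le_mul_right hsq _) _).trans ?_
  rw [← ENNReal.ofReal_mul (by positivity), ← ENNReal.ofReal_mul (by positivity),
    ← ENNReal.ofReal_add (by positivity) (by positivity),
    ← ENNReal.ofReal_add (by positivity) (by positivity),
    ← ENNReal.ofReal_add (by positivity) (by positivity)]
  refine ENNReal.ofReal_le_ofReal (le_of_eq ?_)
  have e1 : τ ^ (q - 2) * (K ^ 2 * ℓ) = K ^ q * (R ^ (1 - q / 2) * ℓ) := by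
    rw [hτdef, Real.mul_rpow hK.le (by positivity), ← Real.rpow_mul hR.le,
      show -(1 / 2) * (q - 2) = 1 - q / 2 by ring, Real.rpow_sub hK, Real.rpow_two]
    field_simp
  have e2 : τ ^ q * (L + L) = K ^ q * (8 * (R ^ (1 - q / 2) * ℓ)) := by
    rw [hτdef, Real.mul_rpow hK.le (by positivity), ← Real.rpow_mul hR.le, hLdef,
      show 1 - q / 2 = -(1 / 2) * q + 1 by ring, Real.rpow_add hR, Real.rpow_one]
    ring
  rw [e1, e2]
  ring

/-- For `t` in the bounded interval `[0, α]`, `1 + x² ≤ 2(1 + α²)(1 + (t - x)²)`, so Schwartz decay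
in `t - x` becomes decay in `x` that is uniform in `t` and integrable. The factor `α` on the
derivative matches the length of the interval in the off-band estimate. -/
theorem exists_window_bound (ψ : 𝓢(ℝ, ℂ)) {α : ℝ} (hα : 0 < α) :
    ∃ C > 0, ∀ x, ∀ t ∈ Set.Icc 0 α,
      ‖ψ (t - x)‖ ≤ C / (1 + x ^ 2) ∧ α * ‖deriv ψ (t - x)‖ ≤ C / (1 + x ^ 2) := by
  have hdec : ∀ φ : 𝓢(ℝ, ℂ), ∃ C, 0 ≤ C ∧ ∀ s, (1 + s ^ 2) * ‖φ s‖ ≤ C := fun φ => by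
    refine ⟨SchwartzMap.seminorm ℝ 0 0 φ + SchwartzMap.seminorm ℝ 2 0 φ, by positivity,
      fun s => ?_⟩
    have h1 := φ.norm_le_seminorm ℝ s
    have h2 := φ.norm_pow_mul_le_seminorm ℝ 2 s
    rw [Real.norm_eq_abs, sq_abs] at h2
    linarith
  obtain ⟨C₀, hC₀, h₀⟩ := hdec ψ
  obtain ⟨C₁, hC₁, h₁⟩ := hdec (SchwartzMap.derivCLM ℝ ℂ ψ)
  refine ⟨2 * (1 + α ^ 2) * (C₀ + α * C₁ + 1), by positivity, fun x t ht => ?_⟩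
  have hx : 1 + x ^ 2 ≤ 2 * (1 + α ^ 2) * (1 + (t - x) ^ 2) := by
    have h1 : t ^ 2 ≤ α ^ 2 := pow_le_pow_left₀ ht.1 ht.2 2
    nlinarith [sq_nonneg (2 * t - x), mul_nonneg (sq_nonneg α) (sq_nonneg (t - x))]
  have hx0 : 0 < 1 + x ^ 2 := by positivity
  have e0 := h₀ (t - x)
  have e1 := h₁ (t - x)
  rw [SchwartzMap.derivCLM_apply] at e1
  constructor
  · rw [le_div_iff₀ hx0]
    calc ‖ψ (t - x)‖ * (1 + x ^ 2) ≤ ‖ψ (t - x)‖ * (2 * (1 + α ^ 2) * (1 + (t - x) ^ 2)) := by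
          gcongr
      _ = 2 * (1 + α ^ 2) * ((1 + (t - x) ^ 2) * ‖ψ (t - x)‖) := by ring
      _ ≤ 2 * (1 + α ^ 2) * (C₀ + α * C₁ + 1) := by
          gcongr; have : 0 ≤ α * C₁ := by positivity
          linarith
  · rw [le_div_iff₀ hx0]
    calc α * ‖deriv ψ (t - x)‖ * (1 + x ^ 2)
        ≤ α * ‖deriv ψ (t - x)‖ * (2 * (1 + α ^ 2) * (1 + (t - x) ^ 2)) := by gcongr
      _ = 2 * (1 + α ^ 2) * (α * ((1 + (t - x) ^ 2) * ‖deriv ψ (t - x)‖)) := by ring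
      _ ≤ 2 * (1 + α ^ 2) * (C₀ + α * C₁ + 1) := by
          gcongr
          have : α * ((1 + (t - x) ^ 2) * ‖deriv ψ (t - x)‖) ≤ α * C₁ := by gcongr
          linarith

/-- The band estimate is used with `K = 2C/(1 + x²)`: one `C/(1 + x²)` bounds the amplitude, the
other bounds its derivative times the length of the interval, which is at most `α`. -/
theorem lintegral_fourier_chirpPiece_le {ψ : 𝓢(ℝ, ℂ)} {C q x : ℝ} (hC : 0 < C)
    (hψ : ∀ t ∈ Set.Icc 0 α,
      ‖ψ (t - x)‖ ≤ C / (1 + x ^ 2) ∧ α * ‖deriv ψ (t - x)‖ ≤ C / (1 + x ^ 2))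
    (hq : 1 < q) (hq2 : q ≤ 2) {j : ℕ} (h0 : 0 ≤ a j) (hlt : a j < a (j + 1))
    (hα : a (j + 1) ≤ α) (hR : 0 < R j) :
    ∫⁻ w, ‖𝓕 (fun t => chirpPiece a R j t * (starRingEnd ℂ) (ψ (t - x))) w‖ₑ ^ q ≤
      ENNReal.ofReal ((2 * C / (1 + x ^ 2)) ^ q * (9 * (R j ^ (1 - q / 2) * (a (j + 1) - a j)) +
        2 * ((4 * R j * (a (j + 1) - a j)) ^ (1 - q) / (q - 1)))) := by
  have hα0 : 0 < α := by linarith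
  have hK : 0 < C / (1 + x ^ 2) := by positivity
  have hmem : ∀ r, MemLp (fun t => chirpPiece a R j t * (starRingEnd ℂ) (ψ (t - x))) r :=
    fun r => memLp_mul_window (memLp_chirpPiece j r) ψ x
  have hi := memLp_one_iff_integrable.1 (hmem 1)
  have hsub : ∀ t ∈ Set.Icc (a j) (a (j + 1)), t ∈ Set.Icc 0 α := fun t ht =>
    ⟨h0.trans ht.1, ht.2.trans hα⟩
  refine lintegral_rpow_le_of_band (memLp_fourier hi (hmem 2)).aestronglyMeasurable hq hq2
    (by positivity) hR (sub_pos.2 hlt) ?_ fun w hw hw0 => ?_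
  · rw [lintegral_enorm_fourier_sq hi (hmem 2), ENNReal.ofReal_mul (by positivity),
      ← lintegral_enorm_chirpPiece_sq (R := R), ← lintegral_const_mul' _ _ ENNReal.ofReal_ne_top]
    refine lintegral_mono fun t => ?_
    by_cases ht : t ∈ Set.Ico (a j) (a (j + 1))
    · rw [enorm_mul, ENNReal.mul_rpow_of_nonneg _ _ (by norm_num), mul_comm]
      gcongr
      rw [← ofReal_norm, ENNReal.ofReal_rpow_of_nonneg (norm_nonneg _) (by norm_num),
        RCLike.norm_conj, Real.rpow_two]
      refine ENNReal.ofReal_le_ofReal (pow_le_pow_left₀ (norm_nonneg _) ?_ 2)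
      refine ((hψ t (hsub t ⟨ht.1, ht.2.le⟩)).1).trans ?_
      rw [mul_div_assoc]; linarith
    · simp [chirpPiece, Set.indicator_of_notMem ht]
  · rw [fourier_chirpPiece_mul j hlt.le]
    have hd : ∀ t, HasDerivAt (fun t => (starRingEnd ℂ) (ψ (t - x)))
        ((starRingEnd ℂ) (deriv ψ (t - x))) t := fun t => by
      exact (HasDerivAt.comp_sub_const t x (ψ.differentiableAt (x := t - x)).hasDerivAt).star
    have hdc : Continuous fun t => (starRingEnd ℂ) (deriv ψ (t - x)) :=
      Complex.continuous_conj.comp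
        ((SchwartzMap.derivCLM ℝ ℂ ψ).continuous.comp (by fun_prop : Continuous fun t => t - x))
    have h := norm_integral_chirp_mul_phase_mul_le hR.le hlt.le hw hw0 hd hdc
      (K₀ := C / (1 + x ^ 2)) (K₁ := C / (1 + x ^ 2) / α)
      (fun t ht => by rw [RCLike.norm_conj]; exact (hψ t (hsub t ht)).1)
      (fun t ht => by
        rw [RCLike.norm_conj, le_div_iff₀ hα0, mul_comm]; exact (hψ t (hsub t ht)).2)
    refine h.trans (div_le_div_of_nonneg_right ?_ (abs_nonneg w))
    have : (a (j + 1) - a j) * (C / (1 + x ^ 2) / α) ≤ α * (C / (1 + x ^ 2) / α) := by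
      gcongr; linarith
    rw [mul_div_cancel₀ _ hα0.ne'] at this
    rw [mul_div_assoc]; linarith

/-- The intervals have total length at most `α - a 0` and the window is bounded, so the `L¹` norms
of the pieces are summable and sum and integral may be exchanged. -/
theorem hasSum_fourier_chirpPiece (ha : Monotone a) (hlt : ∀ j, a j < α) (ψ : 𝓢(ℝ, ℂ))
    (x w : ℝ) :
    HasSum (fun j => 𝓕 (fun t => chirpPiece a R j t * (starRingEnd ℂ) (ψ (t - x))) w)
      (𝓕 (fun t => chirpTrain a R t * (starRingEnd ℂ) (ψ (t - x))) w) := by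
  simp only [Real.fourier_eq']
  set e : ℝ → ℂ := fun t => Complex.exp (((-2 * Real.pi * inner ℝ t w : ℝ) : ℂ) * Complex.I)
    with he
  have hen : ∀ t, ‖e t‖ = 1 := fun t => Complex.norm_exp_ofReal_mul_I _
  have hec : Continuous e := by rw [he]; fun_prop
  set M := SchwartzMap.seminorm ℝ 0 0 ψ
  have hnorm : ∀ j t, ‖e t • (chirpPiece a R j t * (starRingEnd ℂ) (ψ (t - x)))‖
      ≤ (Set.Ico (a j) (a (j + 1))).indicator (fun _ => M) t := fun j t => by
    rw [norm_smul, hen, one_mul, norm_mul, RCLike.norm_conj, norm_chirpPiece]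
    by_cases ht : t ∈ Set.Ico (a j) (a (j + 1))
    · simpa [ht] using ψ.norm_le_seminorm ℝ (t - x)
    · simp [ht]
  have hind : ∀ j, Integrable ((Set.Ico (a j) (a (j + 1))).indicator fun _ => M) := fun j =>
    (integrable_indicator_iff measurableSet_Ico).2 (integrableOn_const (by simp))
  have hinteg : ∀ j, Integrable fun t =>
      e t • (chirpPiece a R j t * (starRingEnd ℂ) (ψ (t - x))) := fun j =>
    (hind j).mono' (hec.aestronglyMeasurable.smul
      (memLp_mul_window (memLp_chirpPiece j 1) ψ x).aestronglyMeasurable)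
      (Eventually.of_forall (hnorm j))
  have hlen : Summable fun j => (a (j + 1) - a j) * M := by
    refine Summable.mul_right _ (summable_of_sum_range_le (c := α - a 0)
      (fun j => sub_nonneg.2 (ha (Nat.le_succ j))) fun n => ?_)
    rw [Finset.sum_range_sub]
    linarith [hlt n]
  have hsum : Summable fun j =>
      ∫ t, ‖e t • (chirpPiece a R j t * (starRingEnd ℂ) (ψ (t - x)))‖ := by
    refine hlen.of_nonneg_of_le (fun j => integral_nonneg fun t => norm_nonneg _) fun j => ?_
    refine (integral_mono (hinteg j).norm (hind j) (hnorm j)).trans (le_of_eq ?_)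
    rw [integral_indicator measurableSet_Ico, setIntegral_const, Real.volume_real_Ico_of_le
      (ha (Nat.le_succ j)), smul_eq_mul]
  have h := hasSum_integral_of_summable_integral_norm hinteg hsum
  have heq : ∫ t, ∑' j, e t • (chirpPiece a R j t * (starRingEnd ℂ) (ψ (t - x)))
      = ∫ t, e t • (chirpTrain a R t * (starRingEnd ℂ) (ψ (t - x))) :=
    integral_congr_ae (Eventually.of_forall fun t =>
      (((hasSum_chirpPiece ha t).mul_right ((starRingEnd ℂ) (ψ (t - x)))).const_smul (e t)).tsum_eq)
  rw [heq] at h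
  exact h

/-- Minkowski's inequality for the partial sums, followed by Fatou's lemma. -/
theorem eLpNorm_le_of_hasSum {X : Type*} [MeasurableSpace X] {μ : Measure X} {F : ℕ → X → ℂ}
    {G : X → ℂ} {q : ℝ≥0∞} (hq : 1 ≤ q) (hF : ∀ j, AEStronglyMeasurable (F j) μ)
    (h : ∀ z, HasSum (fun j => F j z) (G z)) :
    eLpNorm G q μ ≤ ∑' j, eLpNorm (F j) q μ := by
  refine (Lp.eLpNorm_lim_le_liminf_eLpNorm (f := fun n => ∑ j ∈ Finset.range n, F j)
    (fun n => Finset.aestronglyMeasurable_sum _ fun j _ => hF j) G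
    (Eventually.of_forall fun z => ?_)).trans ?_
  · simpa only [Finset.sum_apply] using (h z).tendsto_sum_nat
  · refine liminf_le_of_le (by isBoundedDefault) fun b hb => ?_
    obtain ⟨n, hn⟩ := hb.exists
    exact hn.trans ((eLpNorm_sum_le (fun j _ => hF j) hq).trans (ENNReal.sum_le_tsum _))

/-- The bound for a single piece is a product of a factor in `j` and a factor in `x`. The latter has
a finite integral `I`, so the `L^q(ℝ²)` norm of the `j`-th piece is at most `(S j * I)^(1/q)`, and
Minkowski's inequality needs only the summability of `S j ^ (1/q)`. -/
theorem chirpTrain_mem_modulationSpace {c q : ℝ} (hq : 1 < q) (hq2 : q ≤ 2) (h0 : 0 ≤ a 0)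
    (ha : StrictMono a) (hlt : ∀ j, a j < α) (hR : ∀ j, 0 < R j)
    (hsum : Summable fun j => (9 * (R j ^ (1 - q / 2) * (a (j + 1) - a j)) +
      2 * ((4 * R j * (a (j + 1) - a j)) ^ (1 - q) / (q - 1))) ^ (1 / q))
    (hL : MemLp (fun t => (c : ℂ) * chirpTrain a R t) 2) (ψ : 𝓢(ℝ, ℂ)) :
    (hL.toLp _ : 𝓢'(ℝ, ℂ)) ∈ modulationSpace ψ (ENNReal.ofReal q) (ENNReal.ofReal q) := by
  have hq0 : 0 < q := by linarith
  have hα : 0 < α := h0.trans_lt (hlt 0)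
  have hmeas : Measurable fun t => (c : ℂ) * chirpTrain a R t :=
    (measurable_chirpTrain ha.monotone).const_mul _
  rw [toLp_mem_modulationSpace_iff hmeas hL ψ hq0]
  obtain ⟨C, hC, hψ⟩ := exists_window_bound ψ hα
  set S : ℕ → ℝ := fun j => 9 * (R j ^ (1 - q / 2) * (a (j + 1) - a j)) +
      2 * ((4 * R j * (a (j + 1) - a j)) ^ (1 - q) / (q - 1)) with hS
  have hS0 : ∀ j, 0 ≤ S j := fun j => by
    have h1 := hR j
    have h2 := sub_pos.2 (ha (Nat.lt_succ_self j))
    have h3 : 0 < q - 1 := by linarith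
    have : 0 < a (j + 1) - a j := h2
    simp only [hS]; positivity
  set I := ∫⁻ x : ℝ, ENNReal.ofReal ((2 * C / (1 + x ^ 2)) ^ q) with hI
  have hItop : I < ⊤ := by
    have hle : ∀ x : ℝ, (2 * C / (1 + x ^ 2)) ^ q ≤ (2 * C) ^ q * (1 + x ^ 2)⁻¹ := fun x => by
      have h1 : 1 ≤ 1 + x ^ 2 := by nlinarith [sq_nonneg x]
      rw [Real.div_rpow (by positivity) (by positivity), div_eq_mul_inv]
      gcongr
      calc 1 + x ^ 2 = (1 + x ^ 2) ^ (1 : ℝ) := (Real.rpow_one _).symm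
        _ ≤ (1 + x ^ 2) ^ q := Real.rpow_le_rpow_of_exponent_le h1 hq.le
    refine (lintegral_mono fun x => ENNReal.ofReal_le_ofReal (hle x)).trans_lt ?_
    exact (integrable_inv_one_add_sq.const_mul _).lintegral_lt_top
  set F : ℕ → ℝ × ℝ → ℂ := fun j z =>
    𝓕 (fun t => chirpPiece a R j t * (starRingEnd ℂ) (ψ (t - z.1))) z.2 with hF
  have hFm : ∀ j, Measurable (F j) := fun j =>
    measurable_fourier_mul_window (measurable_chirpPiece j) ψ
  have hq' : ENNReal.ofReal q ≠ 0 := by simpa using hq0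
  have hFn : ∀ j, eLpNorm (F j) (ENNReal.ofReal q) volume
      ≤ ENNReal.ofReal (S j ^ (1 / q)) * I ^ (1 / q) := fun j => by
    rw [eLpNorm_eq_lintegral_rpow_enorm_toReal hq' ENNReal.ofReal_ne_top,
      ENNReal.toReal_ofReal hq0.le, ← ENNReal.ofReal_rpow_of_nonneg (hS0 j) (by positivity),
      ← ENNReal.mul_rpow_of_nonneg _ _ (by positivity)]
    refine ENNReal.rpow_le_rpow ?_ (by positivity)
    rw [Measure.volume_eq_prod, lintegral_prod _ ((hFm j).enorm.pow_const q).aemeasurable, mul_comm,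
      hI, ← lintegral_mul_const' _ _ ENNReal.ofReal_ne_top]
    refine lintegral_mono fun x => ?_
    rw [← ENNReal.ofReal_mul (by positivity)]
    exact lintegral_fourier_chirpPiece_le hC (hψ x) hq hq2 (h0.trans (ha.monotone (Nat.zero_le j)))
      (ha (Nat.lt_succ_self j)) (hlt _).le (hR j)
  set G : ℝ × ℝ → ℂ := fun z =>
    𝓕 (fun t => c * chirpTrain a R t * (starRingEnd ℂ) (ψ (t - z.1))) z.2 with hG
  have hGm : Measurable G := measurable_fourier_mul_window hmeas ψ
  have hGs : ∀ z, HasSum (fun j => ((c : ℂ) • F j) z) (G z) := fun z => by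
    have h := (hasSum_fourier_chirpPiece (R := R) ha.monotone hlt ψ z.1 z.2).const_smul (c : ℂ)
    have hGz : G z
        = (c : ℂ) • 𝓕 (fun t => chirpTrain a R t * (starRingEnd ℂ) (ψ (t - z.1))) z.2 := by
      simp only [hG, Real.fourier_eq']
      rw [← integral_smul]
      congr 1
      funext t
      simp only [smul_eq_mul]; ring
    rw [hGz]
    exact h
  have hbound := eLpNorm_le_of_hasSum (μ := volume) (q := ENNReal.ofReal q)
    (by simpa using hq.le) (fun j => ((hFm j).const_smul (c : ℂ)).aestronglyMeasurable) hGs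
  have hfin : eLpNorm G (ENNReal.ofReal q) volume < ⊤ := by
    refine hbound.trans_lt ?_
    have h1 : ∀ j, eLpNorm ((c : ℂ) • F j) (ENNReal.ofReal q) volume
        ≤ ENNReal.ofReal (S j ^ (1 / q)) * (I ^ (1 / q) * ‖(c : ℂ)‖ₑ) := fun j => by
      rw [eLpNorm_const_smul, mul_comm, ← mul_assoc]
      gcongr
      exact hFn j
    refine (ENNReal.tsum_le_tsum h1).trans_lt ?_
    rw [ENNReal.tsum_mul_right]
    refine ENNReal.mul_lt_top hsum.tsum_ofReal_lt_top (ENNReal.mul_lt_top ?_ enorm_lt_top)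
    exact ENNReal.rpow_lt_top_of_nonneg (by positivity) hItop.ne
  rw [eLpNorm_lt_top_iff_lintegral_rpow_enorm_lt_top hq' ENNReal.ofReal_ne_top,
    ENNReal.toReal_ofReal hq0.le, Measure.volume_eq_prod,
    lintegral_prod _ (hGm.enorm.pow_const q).aemeasurable] at hfin
  exact hfin

/-! ### Choice of the parameters -/

/-- The distance from the `j`-th endpoint to the limit `α` of the endpoints, relative to `α`. -/
noncomputable def gap (q : ℝ) (j : ℕ) : ℝ := 2 ^ (-((j : ℝ) ^ 2 * (1 - q / 2) + j))

/-- The endpoints of the intervals carrying the chirps. -/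
noncomputable def node (α q : ℝ) (j : ℕ) : ℝ := α * (1 - gap q j)

/-- The rate of the `j`-th chirp. -/
noncomputable def rate (j : ℕ) : ℝ := 2 ^ ((j : ℝ) ^ 2)

theorem gap_pos (q : ℝ) (j : ℕ) : 0 < gap q j := by unfold gap; positivity

theorem rate_pos (j : ℕ) : 0 < rate j := by unfold rate; positivity

/-- Halving the gap at each step makes the `j`-th interval length comparable to `gap q j`, between
`α/2` and `α` times it. -/
theorem gap_succ_le {q : ℝ} (hq : q ≤ 2) (j : ℕ) : gap q (j + 1) ≤ gap q j / 2 := by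
  have h : gap q j / 2 = 2 ^ (-((j : ℝ) ^ 2 * (1 - q / 2) + j) - 1) := by
    rw [Real.rpow_sub two_pos, Real.rpow_one, gap]
  rw [h, gap]
  refine Real.rpow_le_rpow_of_exponent_le one_le_two ?_
  push_cast
  have : 0 ≤ (1 - q / 2) * (2 * j + 1) := mul_nonneg (by linarith) (by positivity)
  nlinarith

theorem gap_le {q : ℝ} (hq : q ≤ 2) (j : ℕ) : gap q j ≤ (1 / 2) ^ j := by
  induction j with
  | zero => simp [gap]
  | succ j ih =>
    have := gap_succ_le hq j
    rw [pow_succ]; linarith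

theorem node_succ_sub_node (α q : ℝ) (j : ℕ) :
    node α q (j + 1) - node α q j = α * (gap q j - gap q (j + 1)) := by
  unfold node; ring

theorem node_succ_sub_node_le {α q : ℝ} (hα : 0 < α) (j : ℕ) :
    node α q (j + 1) - node α q j ≤ α * gap q j := by
  rw [node_succ_sub_node]
  have := gap_pos q (j + 1)
  gcongr; linarith

theorem le_node_succ_sub_node {α q : ℝ} (hα : 0 < α) (hq : q ≤ 2) (j : ℕ) :
    α / 2 * gap q j ≤ node α q (j + 1) - node α q j := by
  rw [node_succ_sub_node]
  have := gap_succ_le hq j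
  nlinarith

theorem strictMono_node {α q : ℝ} (hα : 0 < α) (hq : q ≤ 2) : StrictMono (node α q) :=
  strictMono_nat_of_lt_succ fun j => by
    have h1 := le_node_succ_sub_node hα hq j
    have h2 := mul_pos (half_pos hα) (gap_pos q j)
    linarith

theorem node_lt {α : ℝ} (q : ℝ) (hα : 0 < α) (j : ℕ) : node α q j < α := by
  have := mul_pos hα (gap_pos q j)
  unfold node; linarith

theorem node_zero (α q : ℝ) : node α q 0 = 0 := by simp [node, gap]

theorem tendsto_node (α : ℝ) {q : ℝ} (hq : q ≤ 2) : Tendsto (node α q) atTop (𝓝 α) := by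
  have h : Tendsto (gap q) atTop (𝓝 0) :=
    squeeze_zero (fun j => (gap_pos q j).le) (gap_le hq)
      (tendsto_pow_atTop_nhds_zero_of_lt_one (by norm_num) (by norm_num))
  have h' : Tendsto (fun j => α * (1 - gap q j)) atTop (𝓝 α) := by
    simpa using (h.const_sub 1).const_mul α
  exact h'

/-- This exponent contains the threshold: for `s = 1 - p/2` the coefficient of `j²` is `(q - p)/2`,
positive for `p < q` and zero for `p = q`, where only `2^(-j)` remains. -/
theorem gap_mul_rate_rpow (q s : ℝ) (j : ℕ) :
    gap q j * rate j ^ s = 2 ^ ((j : ℝ) ^ 2 * (s - (1 - q / 2)) - j) := by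
  rw [gap, rate, ← Real.rpow_mul two_pos.le, ← Real.rpow_add two_pos]
  congr 1; ring

theorem tendsto_length_mul_rate {α p q : ℝ} (hα : 0 < α) (hq : q ≤ 2) (hpq : p < q) :
    Tendsto (fun j => (node α q (j + 1) - node α q j) * rate j ^ (1 - p / 2)) atTop atTop := by
  have hlow : ∀ j : ℕ, α / 2 * (2 : ℝ) ^ ((j : ℝ) * ((j : ℝ) * ((q - p) / 2) - 1)) ≤
      (node α q (j + 1) - node α q j) * rate j ^ (1 - p / 2) := fun j => by
    have h1 := mul_le_mul_of_nonneg_right (le_node_succ_sub_node hα hq j)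
      (Real.rpow_pos_of_pos (rate_pos j) (1 - p / 2)).le
    rw [mul_assoc, gap_mul_rate_rpow] at h1
    refine le_trans (le_of_eq ?_) h1
    congr 2; ring
  refine tendsto_atTop_mono hlow (Tendsto.const_mul_atTop (half_pos hα) ?_)
  simp only [Real.rpow_def_of_pos two_pos]
  refine Real.tendsto_exp_atTop.comp (Tendsto.const_mul_atTop (Real.log_pos one_lt_two) ?_)
  refine tendsto_natCast_atTop_atTop.atTop_mul_atTop₀ ?_
  exact tendsto_atTop_add_const_right _ _
    (tendsto_natCast_atTop_atTop.atTop_mul_const (by linarith : 0 < (q - p) / 2))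

theorem summable_bandBound {α q : ℝ} (hα : 0 < α) (hq : 1 < q) (hq2 : q ≤ 2) :
    Summable fun j => (9 * (rate j ^ (1 - q / 2) * (node α q (j + 1) - node α q j)) +
      2 * ((4 * rate j * (node α q (j + 1) - node α q j)) ^ (1 - q) / (q - 1))) ^ (1 / q) := by
  have hq1 : 0 < q - 1 := by linarith
  have hl : ∀ j, 0 < node α q (j + 1) - node α q j := fun j =>
    sub_pos.2 (strictMono_node hα hq2 (Nat.lt_succ_self j))
  -- A common ratio for both terms: the band term decays like `2^(-j) ≤ ρ^j` because `q - 1 ≤ 1`,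
  -- and the tail like `ρ^j` because the bandwidth grows at least like `2^j`.
  set ρ : ℝ := 2 ^ (-(q - 1)) with hρ
  have hρ0 : 0 < ρ := by positivity
  have hρ1 : ρ < 1 := Real.rpow_lt_one_of_one_lt_of_neg one_lt_two (by linarith)
  set D := 9 * α + 2 * ((2 * α) ^ (1 - q) * 2 ^ (2 * (q - 1)) / (q - 1)) with hD
  have hD0 : 0 < D := by positivity
  have hle : ∀ j, 9 * (rate j ^ (1 - q / 2) * (node α q (j + 1) - node α q j)) +
      2 * ((4 * rate j * (node α q (j + 1) - node α q j)) ^ (1 - q) / (q - 1)) ≤ D * ρ ^ j :=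
    fun j => by
    have hρj : ρ ^ j = 2 ^ (-(q - 1) * j) := by rw [Real.rpow_mul_natCast two_pos.le]
    have h1 : rate j ^ (1 - q / 2) * (node α q (j + 1) - node α q j) ≤ α * ρ ^ j := by
      calc _ ≤ rate j ^ (1 - q / 2) * (α * gap q j) :=
            mul_le_mul_of_nonneg_left (node_succ_sub_node_le hα j)
              (Real.rpow_pos_of_pos (rate_pos j) _).le
        _ = α * (gap q j * rate j ^ (1 - q / 2)) := by ring
        _ ≤ _ := by
            rw [gap_mul_rate_rpow, hρj]
            gcongr
            · norm_num
            · have : (0 : ℝ) ≤ (j : ℝ) * (2 - q) := mul_nonneg (by positivity) (by linarith)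
              nlinarith
    have h2 : (4 * rate j * (node α q (j + 1) - node α q j)) ^ (1 - q)
        ≤ (2 * α) ^ (1 - q) * 2 ^ (2 * (q - 1)) * ρ ^ j := by
      have hlow : 2 * α * 2 ^ ((j : ℝ) - 2) ≤ 4 * rate j * (node α q (j + 1) - node α q j) := by
        have h3 := mul_le_mul_of_nonneg_left (le_node_succ_sub_node hα hq2 j)
          (mul_pos four_pos (rate_pos j)).le
        have h4 := gap_mul_rate_rpow q 1 j
        rw [Real.rpow_one] at h4
        -- The exponent on the right is `j² q/2 - j ≥ j²/2 - j`, which exceeds `j - 2` by `(j -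
        -- 2)²/2`; the shift by `2` comes from this square.
        have h5 : (2 : ℝ) ^ ((j : ℝ) - 2) ≤ gap q j * rate j := by
          rw [h4]
          refine Real.rpow_le_rpow_of_exponent_le one_le_two ?_
          have : (0 : ℝ) ≤ (j : ℝ) ^ 2 * (q - 1) := by positivity
          nlinarith [sq_nonneg ((j : ℝ) - 2)]
        calc 2 * α * 2 ^ ((j : ℝ) - 2) ≤ 2 * α * (gap q j * rate j) := by gcongr
          _ = 4 * rate j * (α / 2 * gap q j) := by ring
          _ ≤ _ := h3
      refine (Real.rpow_le_rpow_of_nonpos (by positivity) hlow (by linarith)).trans (le_of_eq ?_)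
      rw [Real.mul_rpow (by positivity) (by positivity), ← Real.rpow_mul two_pos.le, mul_assoc, hρj,
        ← Real.rpow_add two_pos]
      congr 2; ring
    calc _ ≤ 9 * (α * ρ ^ j) +
          2 * ((2 * α) ^ (1 - q) * 2 ^ (2 * (q - 1)) * ρ ^ j / (q - 1)) := by gcongr
      _ = D * ρ ^ j := by rw [hD]; ring
  have hgeo : Summable fun j : ℕ => D ^ (1 / q) * (ρ ^ (1 / q)) ^ j :=
    (summable_geometric_of_lt_one (by positivity)
      (Real.rpow_lt_one hρ0.le hρ1 (by positivity))).mul_left _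
  have hnn : ∀ j, 0 ≤ 9 * (rate j ^ (1 - q / 2) * (node α q (j + 1) - node α q j)) +
      2 * ((4 * rate j * (node α q (j + 1) - node α q j)) ^ (1 - q) / (q - 1)) := fun j => by
    have := hl j
    have := rate_pos j
    positivity
  refine hgeo.of_nonneg_of_le (fun j => Real.rpow_nonneg (hnn j) _) fun j => ?_
  refine (Real.rpow_le_rpow (hnn j) (hle j) (by positivity)).trans (le_of_eq ?_)
  rw [Real.mul_rpow hD0.le (by positivity), ← Real.rpow_natCast, ← Real.rpow_natCast,
    ← Real.rpow_mul hρ0.le, ← Real.rpow_mul hρ0.le, mul_comm (j : ℝ)]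

/-- For `α β ≤ 1` and `1 < q ≤ 2` there is a Parseval Gabor frame whose atom belongs to `M^q` but
to no `M^p` with `p < q`. -/
theorem exists_parsevalFrame_mem_modulationSpace {α β q : ℝ} (hα : 0 < α) (hβ : 0 < β)
    (hαβ : α * β ≤ 1) (hq : 1 < q) (hq2 : q ≤ 2) :
    ∃ g : L2, IsParsevalFrame (gaborSystem g α β) ∧ ∀ ψ : 𝓢(ℝ, ℂ), ψ ≠ 0 →
      (g : 𝓢'(ℝ, ℂ)) ∈ modulationSpace ψ (ENNReal.ofReal q) (ENNReal.ofReal q) ∧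
      ∀ p : ℝ, 1 ≤ p → p < q →
        (g : 𝓢'(ℝ, ℂ)) ∉ modulationSpace ψ (ENNReal.ofReal p) (ENNReal.ofReal p) := by
  have hmono := strictMono_node hα hq2
  have hlt := node_lt q hα
  have hlim := tendsto_node α hq2
  have hc := Real.sqrt_pos.2 hβ
  have hL : MemLp (fun t => (Real.sqrt β : ℂ) * chirpTrain (node α q) rate t) 2 :=
    (memLp_chirpTrain hmono.monotone hlt hlim 2).const_mul _
  refine ⟨hL.toLp _, ?_, fun ψ hψ => ⟨?_, fun p hp hpq => ?_⟩⟩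
  · refine isParsevalFrame_of_sq_norm_eq_indicator hα hβ hαβ
      ((measurable_chirpTrain hmono.monotone).const_mul _) (fun t => ?_) hL
    rw [norm_mul, mul_pow, Complex.norm_real, Real.norm_of_nonneg hc.le, Real.sq_sqrt hβ.le,
      norm_chirpTrain hmono.monotone hlt hlim, node_zero]
    by_cases ht : t ∈ Set.Ico 0 α
    · rw [Set.indicator_of_mem ht, Set.indicator_of_mem ht]; ring
    · rw [Set.indicator_of_notMem ht, Set.indicator_of_notMem ht]; ring
  · exact chirpTrain_mem_modulationSpace hq hq2 (node_zero α q).ge hmono hlt rate_pos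
      (summable_bandBound hα hq hq2) hL ψ
  · exact chirpTrain_notMem_modulationSpace hc hp (by linarith) hmono.monotone hlt hlim rate_pos
      (tendsto_length_mul_rate hα hq2 hpq) hL hψ

end Gabor

theorem mainTheorem1 :
    (∀ α β q : ℝ, 0 < α → 0 < β → α * β ≤ 1 → 1 < q → q ≤ 2 →
      ∃ g : Gabor.L2, Gabor.IsFrame (Gabor.gaborSystem g α β) ∧
        ∀ ψ : 𝓢(ℝ, ℂ), ψ ≠ 0 →
          (g : 𝓢'(ℝ, ℂ)) ∈ Gabor.modulationSpace ψ (ENNReal.ofReal q) (ENNReal.ofReal q) ∧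
          ∀ p : ℝ, 1 ≤ p → p < q →
            (g : 𝓢'(ℝ, ℂ)) ∉ Gabor.modulationSpace ψ (ENNReal.ofReal p) (ENNReal.ofReal p)) ∧
    (∀ α β : ℝ, 0 < α → 0 < β → α * β ≤ 1 / 2 →
      ∃ g : Gabor.L2, Gabor.IsParsevalFrame (Gabor.gaborSystem g α β) ∧
        ∀ ψ : 𝓢(ℝ, ℂ), ψ ≠ 0 →
          (g : 𝓢'(ℝ, ℂ)) ∈ Gabor.modulationSpace ψ 2 2 ∧
          ∀ p : ℝ, 1 ≤ p → p < 2 →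
            (g : 𝓢'(ℝ, ℂ)) ∉ Gabor.modulationSpace ψ (ENNReal.ofReal p) (ENNReal.ofReal p)) := by
  refine ⟨fun α β q hα hβ hαβ hq hq2 => ?_, fun α β hα hβ hαβ => ?_⟩
  · obtain ⟨g, hg, h⟩ := Gabor.exists_parsevalFrame_mem_modulationSpace hα hβ hαβ hq hq2
    exact ⟨g, ⟨1, 1, hg⟩, h⟩
  -- The construction is already Parseval for `αβ ≤ 1`, so (b) is its case `q = 2`.
  · obtain ⟨g, hg, h⟩ := Gabor.exists_parsevalFrame_mem_modulationSpace hα hβ (by linarith)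
      one_lt_two le_rfl
    simp only [ENNReal.ofReal_ofNat] at h
    exact ⟨g, hg, h⟩
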